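/- **Model (asynchronous mobile telephone model, aMTM, running asynchronous random spread gossip).** The network is a connected simple graph $G=(V,E)$ on $n\ge 2$ nodes, with vertex expansion $\alpha=\min_{0<|S|\le n/2}|\partial S|/|S|$, where $\partial S$ is the set of nodes outside $S$ with a neighbor in $S$. Every node $u$ holds a finite set $T_u$ of tokens and a store of neighbors, each recorded with the tag last received from it; the store is initially empty. $H$ is an injective hash function on finite token sets (no hash collisions). Starting at time $0$, every node $u$ repeats the following loop. 1. Broadcast the advertisement $H(T_u)$ to all neighbors in $G$. 2. Block until the store is nonempty. 3. Let $P$ be the set of stored neighbors whose recorded tag differs from $H(T_u)$. If $P=\emptyset$, start the next iteration. Otherwise empty the store and choose $v\in P$ uniformly at random. 4. Attempt to connect to $v$ and block until the attempt is resolved. It succeeds unless $v$ is serving another incoming connection at the moment of resolution (a node serves at most one incoming connection at a time, whatever else it is doing). If it fails, start the next iteration. 5. Communicate: one token of the symmetric difference of $T_u$ and $T_v$ (at the moment of connection; nothing if $T_u=T_v$) becomes known to both nodes when the communication ends. Then start the next iteration. All steps are instantaneous except the blocking ones (2, 4, 5). The times and the order of all events, and the tokens chosen in step 5, are determined by a scheduler: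 an adaptive adversary that sees the whole execution so far, including past random choices but not future ones. Given delays $\delta_{update}>0$ and $\delta_{connect},\delta_{comm}\ge 0$ and $\delta_{old}>\delta_{update}$, unknown to the algorithm, the scheduler has to obey these rules. An advertisement sent at time $t$ is received by every neighbor of its sender at least once by time $t+\delta_{update}$, possibly repeatedly and in any order relative to other advertisements, but never after time $t+\delta_{old}$; on receipt it replaces the recorded tag of its sender. Step 2 ends at most $\delta_{update}$ after the first moment of the step at which the store is nonempty. Steps 4 and 5 last at most $\delta_{connect}$ and $\delta_{comm}$. Only finitely many events occur in bounded time. Put $\delta_{max}=\delta_{update}+\delta_{connect}+\delta_{comm}$. **Theorem.** For all real numbers $p>0$ and $K>0$ there is a constant $C>0$ such that the following holds for every connected graph $G$ on $n\ge2$ nodes with vertex expansion $\alpha$, all delays with $\delta_{old}\le K\,\delta_{max}$, and every scheduler obeying the rules. If exactly one token exists ($k=1$), initially known to an arbitrary nonempty set of nodes, then with probability at least $1-n^{-p}$ all $n$ nodes know the token by time $$C\,\delta_{max}\,\sqrt{n/\alpha}\;\log^2(n\alpha).$$ -/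

import Mathlib

noncomputable section

open Classical

/-- The vertex expansion of a finite graph: the minimum of `|∂S| / |S|` over all sets `S` of nodes
with `0 < |S| ≤ n / 2`, where `∂S` is the set of nodes outside `S` that have a neighbor in `S`. -/
def vertexExpansion {V : Type*} [Fintype V] (G : SimpleGraph V) : ℝ :=
  ⨅ S : {S : Finset V // S.Nonempty ∧ 2 * S.card ≤ Fintype.card V},
    ((Finset.univ.filter fun v => v ∉ S.1 ∧ ∃ u ∈ S.1, G.Adj u v).card : ℝ) / (S.1.card : ℝ)

namespace AMTM

/-- The timing parameters of the asynchronous mobile telephone model. -/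
structure Delays where
  update : ℝ
  connect : ℝ
  comm : ℝ
  old : ℝ
  update_pos : 0 < update
  connect_nonneg : 0 ≤ connect
  comm_nonneg : 0 ≤ comm
  update_lt_old : update < old

/-- `δ_max`: the total duration allowed for the blocking steps of one iteration of the loop. -/
def Delays.max (d : Delays) : ℝ := d.update + d.connect + d.comm

/-- What a process is blocked on. All other steps of the loop are instantaneous.
* `waiting s`: in `blockForNeighborUpdates`; `s` is the start of this step or, if the set
  `neighbors` was empty then, the later moment at which it became nonempty (once it has);
* `connecting v s`: in `blockForConnection v`, called at time `s`;
* `communicating v x s`: in `Communicate v` over its outgoing connection to `v`, formed at time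
  `s`, exchanging the token `x` (nothing if `x = none`). -/
inductive Phase (V τ : Type*) where
  | waiting (s : ℝ) : Phase V τ
  | connecting (v : V) (s : ℝ) : Phase V τ
  | communicating (v : V) (x : Option τ) (s : ℝ) : Phase V τ

/-- A call of `update tag`, with the set of processes that have received it so far. -/
structure Ad (V β : Type*) where
  sender : V
  tag : β
  sentAt : ℝ
  reached : Finset V

/-- A global configuration. `nbrs u w` is the last advertisement tag of `w` recorded in the
key-value store `neighbors` of `u` (`none` if `w` is not in the store); `ads` lists all calls of
`update` so far, in chronological order. -/
structure Config (V τ β : Type*) where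
  clock : ℝ
  tokens : V → Finset τ
  nbrs : V → V → Option β
  phase : V → Phase V τ
  ads : List (Ad V β)

/-- The scheduling events.
* `wake u`: `blockForNeighborUpdates` returns at `u`, which then executes `Select`;
* `resolve u x`: the pending connection attempt of `u` succeeds or fails; if it succeeds, `x` is
  the token that the two processes will exchange;
* `finish u`: the communication over the outgoing connection of `u` ends;
* `deliver i w`: process `w` receives the advertisement number `i`. -/
inductive Move (V τ : Type*) where
  | wake (u : V) : Move V τ
  | resolve (u : V) (x : Option τ) : Move V τ
  | finish (u : V) : Move V τ
  | deliver (i : ℕ) (w : V) : Move V τ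

variable {V τ β : Type*}

/-- The store `neighbors` of `u` is nonempty. -/
def Heard (c : Config V τ β) (u : V) : Prop := ∃ w, c.nbrs u w ≠ none

/-- `v` is currently serving an incoming connection. -/
def Busy (c : Config V τ β) (v : V) : Prop := ∃ u x s, c.phase u = Phase.communicating v x s

/-- `x` is a possible choice of "some token in the symmetric difference of `A` and `B`"; there is
none to exchange exactly if `A = B`. -/
def IsExchange (A B : Finset τ) : Option τ → Prop
  | none => A = B
  | some y => (y ∈ A ∧ y ∉ B) ∨ (y ∈ B ∧ y ∉ A)

/-- Process `u` starts an iteration of the loop: it calls `update` with the hash of its token set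
and blocks for neighbor updates. -/
def beginIteration (H : Finset τ → β) (c : Config V τ β) (u : V) : Config V τ β :=
  { c with
    phase := Function.update c.phase u (Phase.waiting c.clock)
    ads := c.ads ++ [⟨u, H (c.tokens u), c.clock, ∅⟩] }

/-- The set `productiveNeighbors` computed by `Select` at `u`: the known neighbors whose recorded
tag differs from the current tag of `u`. -/
def productive [Fintype V] (H : Finset τ → β) (c : Config V τ β) (u : V) : Finset V :=
  Finset.univ.filter fun w => ∃ b, c.nbrs u w = some b ∧ b ≠ H (c.tokens u)

/-- At time zero all processes have called `update` for the first time and wait for neighbors. -/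
def initialConfig [Fintype V] (H : Finset τ → β) (start : V → Finset τ) : Config V τ β where
  clock := 0
  tokens := start
  nbrs := fun _ _ => none
  phase := fun _ => Phase.waiting 0
  ads := Finset.univ.toList.map fun u => ⟨u, H (start u), 0, ∅⟩

/-- Effect of an event, in a configuration whose clock already shows the time of the event. -/
def effect [Fintype V] (H : Finset τ → β) (c : Config V τ β) : Move V τ → PMF (Config V τ β)
  | Move.wake u =>
      if h : (productive H c u).Nonempty then
        (PMF.uniformOfFinset (productive H c u) h).map fun v =>
          { c with
            nbrs := Function.update c.nbrs u fun _ => none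
            phase := Function.update c.phase u (Phase.connecting v c.clock) }
      else PMF.pure (beginIteration H c u)
  | Move.resolve u x =>
      match c.phase u with
      | Phase.connecting v _ =>
          -- A process accepts an attempt unless it is serving another incoming connection.
          if Busy c v then PMF.pure (beginIteration H c u)
          else PMF.pure
            { c with phase := Function.update c.phase u (Phase.communicating v x c.clock) }
      | _ => PMF.pure c
  | Move.finish u =>
      match c.phase u with
      | Phase.communicating v x _ =>
          PMF.pure (beginIteration H
            { c with
              tokens := fun w =>
                if w = u ∨ w = v then c.tokens w ∪ x.toFinset else c.tokens w } u)
      | _ => PMF.pure c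
  | Move.deliver i w =>
      match c.ads[i]? with
      | some a => PMF.pure
          { c with
            nbrs := Function.update c.nbrs w (Function.update (c.nbrs w) a.sender (some a.tag))
            phase := Function.update c.phase w
              (match c.phase w with
                | Phase.waiting s => Phase.waiting (if Heard c w then s else c.clock)
                | p => p)
            ads := c.ads.set i { a with reached := insert w a.reached } }
      | none => PMF.pure c

/-- One step of an execution: the event `m` happens at time `t`. The only randomness is the uniform
choice made by `Select`. -/
def step [Fintype V] (H : Finset τ → β) (c : Config V τ β) (t : ℝ) (m : Move V τ) :
    PMF (Config V τ β) :=
  effect H { c with clock := t } m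

/-- The next event may happen at time `t`: time does not run backwards, and no deadline imposed by
the model is missed. -/
structure TimeOK (d : Delays) (G : SimpleGraph V) (c : Config V τ β) (t : ℝ) : Prop where
  clock_le : c.clock ≤ t
  waiting_le : ∀ u s, c.phase u = Phase.waiting s → Heard c u → t ≤ s + d.update
  connecting_le : ∀ u v s, c.phase u = Phase.connecting v s → t ≤ s + d.connect
  communicating_le : ∀ u v x s, c.phase u = Phase.communicating v x s → t ≤ s + d.comm
  ads_le : ∀ a ∈ c.ads, ∀ w, G.Adj a.sender w → w ∉ a.reached → t ≤ a.sentAt + d.update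

/-- The event can happen in configuration `c` at time `t`. An advertisement can be received by
neighbors of its sender, possibly repeatedly and in any order, until `d.old` after it was sent. -/
def Enabled (d : Delays) (G : SimpleGraph V) (c : Config V τ β) (t : ℝ) : Move V τ → Prop
  | Move.wake u => (∃ s, c.phase u = Phase.waiting s) ∧ Heard c u
  | Move.resolve u x => ∃ v s, c.phase u = Phase.connecting v s ∧
      (¬ Busy c v → IsExchange (c.tokens u) (c.tokens v) x)
  | Move.finish u => ∃ v x s, c.phase u = Phase.communicating v x s
  | Move.deliver i w => ∃ a, c.ads[i]? = some a ∧ G.Adj a.sender w ∧ t ≤ a.sentAt + d.old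

/-- A finite execution: the past configurations, latest first, and the current one. -/
abbrev History (V τ β : Type*) := List (Config V τ β) × Config V τ β

/-- A scheduler is an adaptive adversary: it sees the whole execution so far, including all random
choices already made, and determines the next event and its time. -/
abbrev Scheduler (V τ β : Type*) := History V τ β → ℝ × Move V τ

/-- The distribution of the first `N` steps of the execution of asynchronous random spread gossip
with hash function `H` and initial token sets `start` under the scheduler `σ`. -/
def run [Fintype V] (H : Finset τ → β) (start : V → Finset τ) (σ : Scheduler V τ β) :
    ℕ → PMF (History V τ β)
  | 0 => PMF.pure ([], initialConfig H start)
  | N + 1 => (run H start σ N).bind fun h =>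
      (step H h.2 (σ h).1 (σ h).2).map fun c => (h.2 :: h.1, c)

/-- The scheduler obeys the rules of the model with delays `d` on the network `G`, and time
diverges: it does not schedule infinitely many events in a bounded time. -/
structure Admissible [Fintype V] (d : Delays) (G : SimpleGraph V) (H : Finset τ → β)
    (start : V → Finset τ) (σ : Scheduler V τ β) : Prop where
  timeOK : ∀ N, ∀ h ∈ (run H start σ N).support, TimeOK d G h.2 (σ h).1
  enabled : ∀ N, ∀ h ∈ (run H start σ N).support, Enabled d G h.2 (σ h).1 (σ h).2
  diverges : ∀ T : ℝ, ∃ N, ∀ h ∈ (run H start σ N).support, T < h.2.clock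

/-- In the execution `h`, at some time at most `T`, every process knows the token `x`. -/
def SpreadBy (x : τ) (T : ℝ) (h : History V τ β) : Prop :=
  ∃ c ∈ h.2 :: h.1, c.clock ≤ T ∧ ∀ u, x ∈ c.tokens u

/-- The probability that every process knows the token `x` by time `T`. The events are increasing
in the number `N` of steps, so this is their limit. -/
def probSpreadBy [Fintype V] (H : Finset τ → β) (start : V → Finset τ) (σ : Scheduler V τ β)
    (x : τ) (T : ℝ) : ENNReal :=
  ⨆ N, (run H start σ N).toOuterMeasure {h | SpreadBy x T h}

end AMTM

end

/-!
Only pulls matter: an uninformed process never records a false claim that a neighbor is informed, so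
each of its selections is uniform among some informed neighbors, and it is informed at the end of
every connection that succeeds. The scheduler chooses which neighbors are known at each selection,
but it cannot foresee the choice.

*Hits.* A selection by an uninformed process is a hit if the selected process is *clean* (informed,
and no trace of its outdated tag is left) and is not targeted by anyone else. A hit forces a new
process to become informed: the first attempt to connect succeeds. Counting the processes bound to
inform another one together with the informed processes gives `rank`, which never decreases
(`rank_le_of_transition`) and increases with every hit (`rank_lt_of_select`). Give a hit at rank `r`
the weight `1 / √(max 1 (α min(r, n - r)))`. The weights of all hits add up to at most
`spreadPotential α n n ≤ 5 √(n / α)` (`spreadPotential_le`). If `totalRate` is the sum of the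
conditional expectations of the weighted hits, then `exp (totalRate / 2 - spreadPotential (rank))`
has expectation at most one (`tsum_run_le_one`), so that `totalRate` exceeds a large multiple of
`√(n / α)` only with exponentially small probability (`toOuterMeasure_totalRate_le`).

*Rates.* In every execution, `totalRate` grows at a constant rate, up to the potential of the number
of informed processes (`Execution.exists_progress`). Every process starts a new iteration within
`6 δ_max` (`exists_announced`), informed processes become clean (`clean_of_lt`), and a clean process is
soon offered to each uninformed neighbor in a random selection (`exists_wake_of_clean`). Let `S` be
the informed set at the start of a period of length `δ_old + 48 δ_max`, and let `g` processes become
informed in this period. In the part of the period that begins when all of `S` has been clean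
for `δ_max` and leaves time for the connections to end, at most `g` processes of `S` are targeted
(`card_targeted_le`). Hence an uninformed process with `D` untargeted neighbors in `S` has selections
with at most `2 g` other candidates, and its hit probabilities add up to at least `D / (D + 2 g)`,
however the scheduler distributes the neighbors over its selections. Summing over the uninformed
processes gives at least `(κ - 2 g) / (4 g + 2)`, where `κ` bounds the size of the vertex covers of
the cut of `S` from below (`cover_le_sum_hit_probability`). By vertex expansion, `κ` may be taken of
the order of `max 1 (α min(|S|, n - |S|))`. Hence either `g` is of order `√κ`, and the potential
grows by a constant, or the expected number of hits is at least of order `√κ`, and the total rate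
grows by a constant.

Together, the probability that some process is uninformed at a time that is a large multiple of
`δ_max √(n / α)` is at most `n ^ (-p)`, because `√(n / α)` dominates `log n`. The factor
`log² (n α)` is at least `(log 2)²`.
-/

noncomputable section

open Classical

/-! ### Vertex covers of cuts, and the potential of the number of informed processes -/

section Graph
variable {V : Type*} [Fintype V] (G : SimpleGraph V)

theorem vertexExpansion_mul_card_le (S : Finset V) (hS : S.Nonempty)
    (h : 2 * S.card ≤ Fintype.card V) :
    vertexExpansion G * S.card ≤
      ((Finset.univ.filter fun v => v ∉ S ∧ ∃ u ∈ S, G.Adj u v).card : ℝ) := by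
  have hb : BddBelow (Set.range
      fun S : {S : Finset V // S.Nonempty ∧ 2 * S.card ≤ Fintype.card V} =>
      ((Finset.univ.filter fun v => v ∉ S.1 ∧ ∃ u ∈ S.1, G.Adj u v).card : ℝ) / (S.1.card : ℝ)) :=
    ⟨0, by rintro _ ⟨T, rfl⟩; positivity⟩
  have h1 := ciInf_le hb ⟨S, hS, h⟩
  have h2 : (0 : ℝ) < S.card := by exact_mod_cast hS.card_pos
  exact (le_div_iff₀ h2).1 h1

theorem exists_card_eq_half (hn : 2 ≤ Fintype.card V) :
    ∃ S : Finset V, S.card = Fintype.card V / 2 := by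
  obtain ⟨S, -, hS⟩ := Finset.exists_subset_card_eq (s := (Finset.univ : Finset V))
    (n := Fintype.card V / 2) (by rw [Finset.card_univ]; omega)
  exact ⟨S, hS⟩

theorem vertexExpansion_le_two (hn : 2 ≤ Fintype.card V) : vertexExpansion G ≤ 2 := by
  obtain ⟨S, hS⟩ := exists_card_eq_half (V := V) hn
  have hpos : 0 < S.card := by omega
  have h1 := vertexExpansion_mul_card_le G S (Finset.card_pos.1 hpos) (by omega)
  have h2 : (Finset.univ.filter fun v => v ∉ S ∧ ∃ u ∈ S, G.Adj u v).card ≤ Sᶜ.card := by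
    refine Finset.card_le_card fun v hv => ?_
    simp only [Finset.mem_filter] at hv
    simpa using hv.2.1
  rw [Finset.card_compl] at h2
  have h3 : (Finset.univ.filter fun v => v ∉ S ∧ ∃ u ∈ S, G.Adj u v).card ≤ 2 * S.card := by omega
  have h4 : ((Finset.univ.filter fun v => v ∉ S ∧ ∃ u ∈ S, G.Adj u v).card : ℝ) ≤ 2 * S.card := by
    exact_mod_cast h3
  have h5 : (0 : ℝ) < S.card := by exact_mod_cast hpos
  nlinarith

/-- In a connected graph, an edge leaves every proper nonempty set of nodes. -/
theorem exists_adj_mem_not_mem (hG : G.Connected) (S : Finset V) (hS : S.Nonempty)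
    (hS' : S ≠ Finset.univ) : ∃ u ∈ S, ∃ v ∉ S, G.Adj u v := by
  obtain ⟨a, ha⟩ := hS
  obtain ⟨b, hb⟩ : ∃ b, b ∉ S := by
    by_contra! h
    exact hS' (Finset.eq_univ_iff_forall.2 h)
  obtain ⟨p⟩ := hG.preconnected a b
  obtain ⟨e, -, h1, h2⟩ := p.exists_boundary_dart (↑S) (by simpa using ha) (by simpa using hb)
  exact ⟨e.fst, by simpa using h1, e.snd, by simpa using h2, e.adj⟩

theorem two_le_card_mul_vertexExpansion (hn : 2 ≤ Fintype.card V) (hG : G.Connected) :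
    2 ≤ (Fintype.card V : ℝ) * vertexExpansion G := by
  have hn' : (0 : ℝ) < Fintype.card V := by exact_mod_cast (by omega : 0 < Fintype.card V)
  rw [mul_comm, ← div_le_iff₀ hn']
  obtain ⟨S₀, hS₀⟩ := exists_card_eq_half (V := V) hn
  have : Nonempty {S : Finset V // S.Nonempty ∧ 2 * S.card ≤ Fintype.card V} :=
    ⟨S₀, Finset.card_pos.1 (by omega), by omega⟩
  refine le_ciInf fun ⟨S, hS, hc⟩ => ?_
  have hpos := hS.card_pos
  have hne : S ≠ Finset.univ := by
    rintro rfl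
    rw [Finset.card_univ] at hc; omega
  obtain ⟨u, hu, v, hv, huv⟩ := exists_adj_mem_not_mem G hG S hS hne
  have h1 : 1 ≤ (Finset.univ.filter fun v => v ∉ S ∧ ∃ u ∈ S, G.Adj u v).card :=
    Finset.card_pos.2 ⟨v, by simpa using ⟨hv, u, hu, huv⟩⟩
  have h2 : (0 : ℝ) < S.card := by exact_mod_cast hpos
  have h3 : (2 : ℝ) * S.card ≤ Fintype.card V := by exact_mod_cast hc
  have h4 : (1 : ℝ) ≤ (Finset.univ.filter fun v => v ∉ S ∧ ∃ u ∈ S, G.Adj u v).card := by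
    exact_mod_cast h1
  rw [div_le_div_iff₀ hn' h2]
  nlinarith

/-- Removing a vertex cover of a cut from the smaller side of the cut leaves a set whose boundary
lies in the cover, so that the cover cannot be small. -/
theorem vertexExpansion_mul_card_le_cover_of_small (hn : 2 ≤ Fintype.card V)
    (hα : 0 ≤ vertexExpansion G) (S C : Finset V) (hS : 2 * S.card ≤ Fintype.card V)
    (hC : ∀ u ∈ S, ∀ v ∉ S, G.Adj u v → u ∈ C ∨ v ∈ C) :
    vertexExpansion G * S.card ≤ 3 * C.card := by
  have h2 := vertexExpansion_le_two G hn
  have hsplit : S.card ≤ (S \ C).card + C.card := Finset.card_le_card_sdiff_add_card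
  have hsplit' : (S.card : ℝ) ≤ (S \ C).card + C.card := by exact_mod_cast hsplit
  have hC0 : (0 : ℝ) ≤ C.card := by positivity
  have key : vertexExpansion G * (S \ C).card ≤ C.card := by
    rcases (S \ C).eq_empty_or_nonempty with h | h
    · rw [h]; simp
    · have hle : (S \ C).card ≤ S.card := Finset.card_le_card Finset.sdiff_subset
      refine (vertexExpansion_mul_card_le G _ h (by omega)).trans ?_
      have : (Finset.univ.filter fun v => v ∉ S \ C ∧ ∃ u ∈ S \ C, G.Adj u v) ⊆ C := by
        intro v hv
        simp only [Finset.mem_filter, Finset.mem_univ, true_and, Finset.mem_sdiff, not_and,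
          not_not] at hv
        obtain ⟨h1, u, ⟨hu, huC⟩, huv⟩ := hv
        by_cases hvS : v ∈ S
        · exact h1 hvS
        · exact (hC u hu v hvS huv).resolve_left huC
      exact_mod_cast Finset.card_le_card this
  nlinarith

theorem vertexExpansion_mul_min_le_cover (hn : 2 ≤ Fintype.card V)
    (hα : 0 ≤ vertexExpansion G) (S C : Finset V)
    (hC : ∀ u ∈ S, ∀ v ∉ S, G.Adj u v → u ∈ C ∨ v ∈ C) :
    vertexExpansion G * min (S.card : ℝ) (Fintype.card V - S.card) ≤ 3 * C.card := by
  by_cases h : 2 * S.card ≤ Fintype.card V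
  · exact (mul_le_mul_of_nonneg_left (min_le_left _ _) hα).trans
      (vertexExpansion_mul_card_le_cover_of_small G hn hα S C h hC)
  · have hle : S.card ≤ Fintype.card V := Finset.card_le_univ S
    have h1 := vertexExpansion_mul_card_le_cover_of_small G hn hα Sᶜ C
      (by rw [Finset.card_compl]; omega) (by
        intro u hu v hv huv
        rw [Finset.mem_compl] at hu
        rw [Finset.mem_compl, not_not] at hv
        exact (hC v hv u hu huv.symm).symm)
    rw [Finset.card_compl, Nat.cast_sub hle] at h1
    exact (mul_le_mul_of_nonneg_left (min_le_right _ _) hα).trans h1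

end Graph

section Weight

/-- The weight of one newly informed node when `r` of `n` nodes are informed, for vertex expansion
`α`: up to constants, the inverse of the number of nodes informed per unit of time. -/
def spreadWeight (α : ℝ) (n r : ℕ) : ℝ := 1 / √(max 1 (α * min (r : ℝ) (n - r)))

/-- The total weight of the first `s` informed nodes; the weight of a node is taken at the number of
nodes informed before it. -/
def spreadPotential (α : ℝ) (n s : ℕ) : ℝ := ∑ i ∈ Finset.range s, spreadWeight α n i

theorem spreadWeight_pos (α : ℝ) (n r : ℕ) : 0 < spreadWeight α n r := by
  have : (1 : ℝ) ≤ max 1 (α * min (r : ℝ) (n - r)) := le_max_left _ _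
  unfold spreadWeight; positivity

theorem spreadWeight_le_one (α : ℝ) (n r : ℕ) : spreadWeight α n r ≤ 1 := by
  have h : (1 : ℝ) ≤ √(max 1 (α * min (r : ℝ) (n - r))) := Real.one_le_sqrt.2 (le_max_left _ _)
  exact (div_le_one (by linarith)).2 h

theorem le_spreadWeight (α : ℝ) (n r : ℕ) {B : ℝ} (h1 : 1 ≤ B)
    (h : α * min (r : ℝ) (n - r) ≤ B) : 1 / √B ≤ spreadWeight α n r := by
  have h0 : (1 : ℝ) ≤ max 1 (α * min (r : ℝ) (n - r)) := le_max_left _ _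
  exact one_div_le_one_div_of_le (Real.sqrt_pos.2 (by linarith))
    (Real.sqrt_le_sqrt (max_le h1 h))

theorem spreadPotential_mono (α : ℝ) (n : ℕ) : Monotone (spreadPotential α n) :=
  monotone_nat_of_le_succ fun s => by
    rw [spreadPotential, spreadPotential, Finset.sum_range_succ]
    linarith [spreadWeight_pos α n s]

theorem spreadPotential_nonneg (α : ℝ) (n s : ℕ) : 0 ≤ spreadPotential α n s :=
  Finset.sum_nonneg fun i _ => (spreadWeight_pos α n i).le

theorem sum_one_div_sqrt_le (n : ℕ) :
    ∑ i ∈ Finset.range n, 1 / √((i : ℝ) + 1) ≤ 2 * √n := by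
  induction n with
  | zero => simp
  | succ n ih =>
    rw [Finset.sum_range_succ]
    have ha : 0 < √((n : ℝ) + 1) := Real.sqrt_pos.2 (by positivity)
    have hb : 0 ≤ √(n : ℝ) := Real.sqrt_nonneg _
    have ha2 : √((n : ℝ) + 1) ^ 2 = n + 1 := Real.sq_sqrt (by positivity)
    have hb2 : √(n : ℝ) ^ 2 = n := Real.sq_sqrt (by positivity)
    have : 1 / √((n : ℝ) + 1) ≤ 2 * √((n : ℝ) + 1) - 2 * √n := by
      rw [div_le_iff₀ ha]
      nlinarith [sq_nonneg (√((n : ℝ) + 1) - √n)]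
    push_cast
    linarith

theorem spreadWeight_succ_le {α : ℝ} (hα : 0 < α) {n r : ℕ} (hr : r + 1 < n) :
    spreadWeight α n (r + 1) ≤
      1 / √α * (1 / √((r : ℝ) + 1) + 1 / √(((n - 2 - r : ℕ) : ℝ) + 1)) := by
  have hcast : (((n - 2 - r : ℕ) : ℝ) + 1) = n - (r + 1 : ℕ) := by
    rw [show n - 2 - r = n - (r + 2) by omega, Nat.cast_sub (by omega)]; push_cast; ring
  have hpos : (0 : ℝ) < (r : ℝ) + 1 := by positivity
  have hpos' : (0 : ℝ) < ((n - 2 - r : ℕ) : ℝ) + 1 := by positivity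
  have h1 : (0 : ℝ) ≤ 1 / √((r : ℝ) + 1) := by positivity
  have h2 : (0 : ℝ) ≤ 1 / √(((n - 2 - r : ℕ) : ℝ) + 1) := by positivity
  have h3 : (0 : ℝ) < 1 / √α := by positivity
  unfold spreadWeight
  rw [← hcast]
  have key : ∀ y : ℝ, 0 < y →
      α * y ≤ max 1 (α * min ((r + 1 : ℕ) : ℝ) (((n - 2 - r : ℕ) : ℝ) + 1)) →
      1 / √(max 1 (α * min ((r + 1 : ℕ) : ℝ) (((n - 2 - r : ℕ) : ℝ) + 1))) ≤ 1 / √α * (1 / √y) := by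
    intro y hy hle
    rw [one_div_mul_one_div, ← Real.sqrt_mul hα.le]
    exact one_div_le_one_div_of_le (Real.sqrt_pos.2 (by positivity)) (Real.sqrt_le_sqrt hle)
  rcases le_total ((r + 1 : ℕ) : ℝ) (((n - 2 - r : ℕ) : ℝ) + 1) with h | h
  · refine (key ((r : ℝ) + 1) hpos ?_).trans (by nlinarith)
    rw [min_eq_left h]; push_cast; exact le_max_right _ _
  · refine (key _ hpos' ?_).trans (by nlinarith)
    rw [min_eq_right h]; exact le_max_right _ _

theorem spreadPotential_le {α : ℝ} (hα : 0 < α) (hα2 : α ≤ 2) {n : ℕ} (hn : 2 ≤ n) :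
    spreadPotential α n n ≤ 5 * √(n / α) := by
  obtain ⟨k, rfl⟩ : ∃ k, n = k + 1 := ⟨n - 1, by omega⟩
  have hsum : ∑ i ∈ Finset.range k, spreadWeight α (k + 1) (i + 1) ≤
      ∑ i ∈ Finset.range k, 1 / √α * (1 / √((i : ℝ) + 1) + 1 / √(((k - 1 - i : ℕ) : ℝ) + 1)) := by
    refine Finset.sum_le_sum fun i hi => ?_
    have hi := Finset.mem_range.1 hi
    have := spreadWeight_succ_le hα (n := k + 1) (r := i) (by omega)
    rwa [show k + 1 - 2 - i = k - 1 - i by omega] at this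
  rw [← Finset.mul_sum, Finset.sum_add_distrib,
    Finset.sum_range_reflect (fun i : ℕ => 1 / √((i : ℝ) + 1)) k] at hsum
  have h1 := sum_one_div_sqrt_le k
  have h2 : √(k : ℝ) ≤ √((k + 1 : ℕ) : ℝ) := Real.sqrt_le_sqrt (by push_cast; linarith)
  have h3 : 1 ≤ √(((k + 1 : ℕ) : ℝ) / α) := by
    refine Real.one_le_sqrt.2 ((one_le_div hα).2 ?_)
    have : (2 : ℝ) ≤ ((k + 1 : ℕ) : ℝ) := by exact_mod_cast hn
    linarith
  have h4 : √(((k + 1 : ℕ) : ℝ) / α) = 1 / √α * √((k + 1 : ℕ) : ℝ) := by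
    rw [Real.sqrt_div (by positivity)]; ring
  have h5 : (0 : ℝ) < 1 / √α := by positivity
  have h6 := spreadWeight_le_one α (k + 1) 0
  rw [spreadPotential, Finset.sum_range_succ']
  nlinarith

/-- If the weight of a node is of order `1 / √κ`, then about `√κ` further nodes raise the potential by
a constant. Only the first `⌈√κ / 8⌉` of the `g` nodes are used, as the weights may shrink later. -/
theorem spreadPotential_gain {α : ℝ} (hα : 0 ≤ α) (hα2 : α ≤ 2) {n s g : ℕ} {κ : ℝ} (hκ : 1 ≤ κ)
    (hs : α * min (s : ℝ) (n - s) ≤ 3 * κ) (hg : √κ / 8 ≤ g) :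
    1 / 20 ≤ spreadPotential α n (s + g) - spreadPotential α n s := by
  have hκs : 1 ≤ √κ := Real.one_le_sqrt.2 hκ
  have hκsq : √κ ^ 2 = κ := Real.sq_sqrt (by linarith)
  set k := ⌈√κ / 8⌉₊ with hk
  have hkg : k ≤ g := Nat.ceil_le.2 hg
  have hk1 : √κ / 8 ≤ k := Nat.le_ceil _
  have hk2 : (k : ℝ) < √κ / 8 + 1 := Nat.ceil_lt_add_one (by positivity)
  have hmono := spreadPotential_mono α n (Nat.add_le_add_left hkg s)
  have hsum : (k : ℝ) * (1 / √(5 * κ)) ≤ spreadPotential α n (s + k) - spreadPotential α n s := by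
    rw [spreadPotential, spreadPotential, Finset.sum_range_add, add_sub_cancel_left]
    rw [← nsmul_eq_mul]
    refine (Finset.card_nsmul_le_sum (Finset.range k) _ (1 / √(5 * κ)) fun i hi => ?_).trans_eq'
      (by simp)
    have hi' : i + 1 ≤ k := Finset.mem_range.1 hi
    have hi2 : (i : ℝ) + 1 ≤ k := by exact_mod_cast hi'
    refine le_spreadWeight _ _ _ (by linarith) ?_
    have hm : min (((s + i : ℕ) : ℝ)) ((n : ℝ) - ((s + i : ℕ) : ℝ)) ≤ min (s : ℝ) (n - s) + i := by
      push_cast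
      rw [min_add_add_right _ _ _ |>.symm]
      refine min_le_min le_rfl ?_
      have : (0 : ℝ) ≤ i := by positivity
      linarith
    have := mul_le_mul_of_nonneg_left hm hα
    nlinarith
  have h5 : √(5 * κ) = √5 * √κ := Real.sqrt_mul (by norm_num) _
  have h6 : √5 ≤ 2.5 := by rw [Real.sqrt_le_left (by norm_num)]; norm_num
  have h7 : 0 < √5 := by positivity
  have h8 : 1 / 20 ≤ (k : ℝ) * (1 / √(5 * κ)) := by
    rw [h5, mul_one_div, le_div_iff₀ (by positivity)]
    nlinarith
  linarith

end Weight

/-! ### Transitions between configurations, and their invariants -/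

namespace AMTM

variable {V τ β : Type*}

/-- The process with which a process is connected, or tries to connect, over an outgoing
connection. -/
def Phase.target : Phase V τ → Option V
  | .waiting _ => none
  | .connecting v _ => some v
  | .communicating v _ _ => some v

/-- The configuration `c` at the later time `t`. -/
abbrev Config.atTime (c : Config V τ β) (t : ℝ) : Config V τ β := { c with clock := t }

/-- The configuration in which `u` and `v` have learned the exchanged token `y`. -/
abbrev Config.exchange (c : Config V τ β) (u v : V) (y : Option τ) : Config V τ β :=
  { c with tokens := fun w => if w = u ∨ w = v then c.tokens w ∪ y.toFinset else c.tokens w }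

section Transition

variable [Fintype V] (d : Delays) (G : SimpleGraph V) (H : Finset τ → β)

/-- The possible outcomes of an enabled event, as a relation between configurations. The time `t` of
the event is the clock of the second configuration; the deadlines are left to `TimeOK`. -/
inductive Transition : Config V τ β → Move V τ → Config V τ β → Prop
  | idle {c : Config V τ β} {u : V} {t s : ℝ} (hu : c.phase u = .waiting s)
      (hh : Heard c u) (hP : productive H c u = ∅) :
      Transition c (.wake u) (beginIteration H (c.atTime t) u)
  | select {c : Config V τ β} {u v : V} {t s : ℝ} (hu : c.phase u = .waiting s)
      (hv : v ∈ productive H c u) :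
      Transition c (.wake u)
        { c.atTime t with
          nbrs := Function.update c.nbrs u fun _ => none
          phase := Function.update c.phase u (.connecting v t) }
  | reject {c : Config V τ β} {u v : V} {y : Option τ} {t s : ℝ}
      (hu : c.phase u = .connecting v s) (hb : Busy c v) :
      Transition c (.resolve u y) (beginIteration H (c.atTime t) u)
  | accept {c : Config V τ β} {u v : V} {y : Option τ} {t s : ℝ}
      (hu : c.phase u = .connecting v s) (hb : ¬ Busy c v)
      (hy : IsExchange (c.tokens u) (c.tokens v) y) :
      Transition c (.resolve u y)
        { c.atTime t with phase := Function.update c.phase u (.communicating v y t) }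
  | finish {c : Config V τ β} {u v : V} {y : Option τ} {t s : ℝ}
      (hu : c.phase u = .communicating v y s) :
      Transition c (.finish u) (beginIteration H ((c.atTime t).exchange u v y) u)
  | deliver {c : Config V τ β} {i : ℕ} {w : V} {a : Ad V β} {t : ℝ}
      (ha : c.ads[i]? = some a) (hadj : G.Adj a.sender w) (ht : t ≤ a.sentAt + d.old) :
      Transition c (.deliver i w)
        { c.atTime t with
          nbrs := Function.update c.nbrs w (Function.update (c.nbrs w) a.sender (some a.tag))
          phase := Function.update c.phase w
            (match c.phase w with
              | .waiting s => .waiting (if Heard c w then s else t)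
              | p => p)
          ads := c.ads.set i { a with reached := insert w a.reached } }

variable {d G H}

theorem transition_of_mem_support {c c' : Config V τ β} {t : ℝ} {m : Move V τ}
    (hm : Enabled d G c t m) (hc : c' ∈ (step H c t m).support) :
    Transition d G H c m c' ∧ c'.clock = t := by
  cases m with
  | wake u =>
    obtain ⟨⟨s, hs⟩, hh⟩ := hm
    simp only [step, effect] at hc
    split_ifs at hc with hP
    · simp only [PMF.support_map, Set.mem_image, PMF.mem_support_uniformOfFinset_iff] at hc
      obtain ⟨v, hv, rfl⟩ := hc
      exact ⟨.select hs hv, rfl⟩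
    · simp only [PMF.pure_apply, PMF.mem_support_iff, ne_eq, ite_eq_right_iff, one_ne_zero,
        imp_false, not_not] at hc
      subst hc
      exact ⟨.idle hs hh (Finset.not_nonempty_iff_eq_empty.1 hP), rfl⟩
  | resolve u y =>
    obtain ⟨v, s, hs, hx⟩ := hm
    simp only [step, effect, hs] at hc
    split_ifs at hc with hP
    · rw [PMF.mem_support_pure_iff] at hc
      subst hc
      exact ⟨.reject hs hP, rfl⟩
    · rw [PMF.mem_support_pure_iff] at hc
      subst hc
      exact ⟨.accept hs hP (hx hP), rfl⟩
  | finish u =>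
    obtain ⟨v, y, s, hs⟩ := hm
    simp only [step, effect, hs] at hc
    rw [PMF.mem_support_pure_iff] at hc
    subst hc
    exact ⟨.finish hs, rfl⟩
  | deliver i w =>
    obtain ⟨a, ha, hadj, ht⟩ := hm
    simp only [step, effect, ha] at hc
    rw [PMF.mem_support_pure_iff] at hc
    subst hc
    exact ⟨.deliver ha hadj ht, rfl⟩

theorem Transition.tokens_subset {c c' : Config V τ β} {m : Move V τ}
    (h : Transition d G H c m c') (w : V) : c.tokens w ⊆ c'.tokens w := by
  cases h <;> simp only [beginIteration, subset_refl]
  split_ifs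
  · exact Finset.subset_union_left
  · exact subset_rfl

end Transition

section Invariant

variable (G : SimpleGraph V) (H : Finset τ → β) (x : τ)

/-- The invariants of all executions with the single token `x`. Records of and advertisements with
the tag `H {x}` are truthful, since an informed process stays informed; hence an uninformed process
selects only informed ones. The last field is what excludes a deadlock: of two neighbors that both
wait with an empty store, one has an advertisement still to be delivered to the other. -/
structure Invariant (c : Config V τ β) : Prop where
  tokens : ∀ u, c.tokens u = ∅ ∨ c.tokens u = {x}
  ads_le : ∀ a ∈ c.ads, a.sentAt ≤ c.clock
  ads_tag : ∀ a ∈ c.ads, a.tag = H ∅ ∨ a.tag = H {x} ∧ x ∈ c.tokens a.sender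
  nbrs : ∀ w u b, c.nbrs w u = some b → G.Adj u w ∧ (b = H ∅ ∨ b = H {x} ∧ x ∈ c.tokens u)
  target : ∀ v u, (c.phase v).target = some u → x ∉ c.tokens v → x ∈ c.tokens u
  comm : ∀ v u y s, c.phase v = .communicating u y s →
    (y = none ∨ y = some x) ∧ (x ∉ c.tokens v → y = some x)
  waiting_le : ∀ u s, c.phase u = .waiting s → s ≤ c.clock
  connecting_le : ∀ u v s, c.phase u = .connecting v s → s ≤ c.clock
  communicating_le : ∀ u v y s, c.phase u = .communicating v y s → s ≤ c.clock
  undelivered : ∀ u w s s', G.Adj u w → c.phase u = .waiting s → c.phase w = .waiting s' →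
    ¬ Heard c u → ¬ Heard c w →
    ∃ a ∈ c.ads, a.sentAt ≤ max s s' ∧
      (a.sender = u ∧ w ∉ a.reached ∨ a.sender = w ∧ u ∉ a.reached)

variable {G H x}

theorem Invariant.tokens_eq_empty {c : Config V τ β} (h : Invariant G H x c) {u : V}
    (hu : x ∉ c.tokens u) : c.tokens u = ∅ :=
  (h.tokens u).resolve_right fun h' => hu (by simp [h'])

theorem Invariant.tokens_eq_singleton {c : Config V τ β} (h : Invariant G H x c) {u : V}
    (hu : x ∈ c.tokens u) : c.tokens u = {x} :=
  (h.tokens u).resolve_left fun h' => by simp [h'] at hu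

theorem Invariant.atTime {c : Config V τ β} (h : Invariant G H x c) {t : ℝ} (ht : c.clock ≤ t) :
    Invariant G H x (c.atTime t) where
  tokens := h.tokens
  ads_le a ha := (h.ads_le a ha).trans ht
  ads_tag := h.ads_tag
  nbrs := h.nbrs
  target := h.target
  comm := h.comm
  waiting_le u s hu := (h.waiting_le u s hu).trans ht
  connecting_le u v s hu := (h.connecting_le u v s hu).trans ht
  communicating_le u v y s hu := (h.communicating_le u v y s hu).trans ht
  undelivered := h.undelivered

theorem Invariant.beginIteration {c : Config V τ β} (h : Invariant G H x c) (u : V) :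
    Invariant G H x (beginIteration H c u) where
  tokens := h.tokens
  ads_le a ha := by
    rcases List.mem_append.1 ha with ha | ha
    · exact h.ads_le a ha
    · rw [List.mem_singleton.1 ha]; exact le_rfl
  ads_tag a ha := by
    rcases List.mem_append.1 ha with ha | ha
    · exact h.ads_tag a ha
    · rw [List.mem_singleton.1 ha]
      by_cases hx : x ∈ c.tokens u
      · exact .inr ⟨by rw [h.tokens_eq_singleton hx], hx⟩
      · exact .inl (by rw [h.tokens_eq_empty hx])
  nbrs := h.nbrs
  target v w hv := by
    simp only [AMTM.beginIteration, Function.update_apply] at hv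
    split_ifs at hv
    · simp [Phase.target] at hv
    · exact h.target v w hv
  comm v w y s hv := by
    simp only [AMTM.beginIteration, Function.update_apply] at hv
    split_ifs at hv
    exact h.comm v w y s hv
  waiting_le v s hv := by
    simp only [AMTM.beginIteration, Function.update_apply] at hv
    split_ifs at hv
    · cases hv; exact le_rfl
    · exact h.waiting_le v s hv
  connecting_le v w s hv := by
    simp only [AMTM.beginIteration, Function.update_apply] at hv
    split_ifs at hv
    exact h.connecting_le v w s hv
  communicating_le v w y s hv := by
    simp only [AMTM.beginIteration, Function.update_apply] at hv
    split_ifs at hv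
    exact h.communicating_le v w y s hv
  undelivered v w s s' hadj hv hw hv' hw' := by
    simp only [AMTM.beginIteration, Function.update_apply] at hv hw
    simp only [AMTM.beginIteration, List.mem_append, List.mem_singleton]
    split_ifs at hv hw with h1 h2 h2
    · exact absurd (h1.trans h2.symm) hadj.ne
    · cases hv
      exact ⟨_, .inr rfl, le_max_left _ _, .inl ⟨h1.symm, by simp⟩⟩
    · cases hw
      exact ⟨_, .inr rfl, le_max_right _ _, .inr ⟨h2.symm, by simp⟩⟩
    · obtain ⟨a, ha, h3⟩ := h.undelivered v w s s' hadj hv hw hv' hw'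
      exact ⟨a, .inl ha, h3⟩

theorem Config.tokens_subset_exchange (c : Config V τ β) (u v : V) (y : Option τ) (w : V) :
    c.tokens w ⊆ (c.exchange u v y).tokens w := by
  simp only
  split_ifs
  · exact Finset.subset_union_left
  · exact subset_rfl

theorem Invariant.exchange {c : Config V τ β} (h : Invariant G H x c) {u v : V} {y : Option τ}
    (hy : y = none ∨ y = some x) : Invariant G H x (c.exchange u v y) where
  tokens w := by
    simp only
    split_ifs
    · rcases h.tokens w with h1 | h1 <;> rcases hy with rfl | rfl <;> simp [h1]
    · exact h.tokens w
  ads_le := h.ads_le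
  ads_tag a ha := (h.ads_tag a ha).imp_right fun h1 =>
    ⟨h1.1, c.tokens_subset_exchange _ _ _ _ h1.2⟩
  nbrs w w' b hb := ⟨(h.nbrs w w' b hb).1, (h.nbrs w w' b hb).2.imp_right fun h1 =>
    ⟨h1.1, c.tokens_subset_exchange _ _ _ _ h1.2⟩⟩
  target w w' hw hx := c.tokens_subset_exchange _ _ _ _
    (h.target w w' hw fun h1 => hx (c.tokens_subset_exchange _ _ _ _ h1))
  comm w w' z s hw := ⟨(h.comm w w' z s hw).1, fun hx =>
    (h.comm w w' z s hw).2 fun h1 => hx (c.tokens_subset_exchange _ _ _ _ h1)⟩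
  waiting_le := h.waiting_le
  connecting_le := h.connecting_le
  communicating_le := h.communicating_le
  undelivered := h.undelivered

theorem invariant_initialConfig [Fintype V] {start : V → Finset τ}
    (hs : ∀ u, start u = ∅ ∨ start u = {x}) : Invariant G H x (initialConfig (V := V) H start) where
  tokens := hs
  ads_le a ha := by
    obtain ⟨u, -, rfl⟩ := List.mem_map.1 ha
    exact le_rfl
  ads_tag a ha := by
    obtain ⟨u, -, rfl⟩ := List.mem_map.1 ha
    rcases hs u with h | h
    · exact .inl (by simp [h])
    · exact .inr (by simp [h, initialConfig])
  nbrs w u b hb := by simp [initialConfig] at hb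
  target v u hv := by simp [initialConfig, Phase.target] at hv
  comm v u y s hv := by simp [initialConfig] at hv
  waiting_le u s hu := by
    simp only [initialConfig, Phase.waiting.injEq] at hu
    exact hu.symm.le
  connecting_le u v s hu := by simp [initialConfig] at hu
  communicating_le u v y s hu := by simp [initialConfig] at hu
  undelivered u w s s' _ hu _ _ _ := by
    simp only [initialConfig, Phase.waiting.injEq] at hu
    refine ⟨⟨u, H (start u), 0, ∅⟩, List.mem_map.2 ⟨u, by simp, rfl⟩, ?_, .inl ⟨rfl, by simp⟩⟩
    subst hu
    exact le_max_left _ _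

variable {d : Delays}

theorem Invariant.mem_of_mem_productive [Fintype V] {c : Config V τ β}
    (h : Invariant G H x c) {u v : V}
    (hv : v ∈ productive H c u) (hu : x ∉ c.tokens u) : x ∈ c.tokens v := by
  simp only [productive, Finset.mem_filter, Finset.mem_univ, true_and] at hv
  obtain ⟨b, hb, hne⟩ := hv
  rw [h.tokens_eq_empty hu] at hne
  exact ((h.nbrs u v b hb).2.resolve_left hne).2

theorem Invariant.select [Fintype V] {c : Config V τ β} (h : Invariant G H x c) {u v : V}
    (hv : v ∈ productive H c u) :
    Invariant G H x { c with
          nbrs := Function.update c.nbrs u fun _ => none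
          phase := Function.update c.phase u (.connecting v c.clock) } where
  tokens := h.tokens
  ads_le := h.ads_le
  ads_tag := h.ads_tag
  nbrs w w' b hb := by
    simp only [Function.update_apply] at hb
    split_ifs at hb
    exact h.nbrs w w' b hb
  target w w' hw hx := by
    simp only [Function.update_apply] at hw
    split_ifs at hw with h1
    · simp only [Phase.target, Option.some.injEq] at hw
      subst h1; subst hw
      exact h.mem_of_mem_productive hv hx
    · exact h.target w w' hw hx
  comm w w' y s hw := by
    simp only [Function.update_apply] at hw
    split_ifs at hw
    exact h.comm w w' y s hw
  waiting_le w s hw := by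
    simp only [Function.update_apply] at hw
    split_ifs at hw
    exact h.waiting_le w s hw
  connecting_le w w' s hw := by
    simp only [Function.update_apply] at hw
    split_ifs at hw
    · cases hw; exact le_rfl
    · exact h.connecting_le w w' s hw
  communicating_le w w' y s hw := by
    simp only [Function.update_apply] at hw
    split_ifs at hw
    exact h.communicating_le w w' y s hw
  undelivered w w' s s' hadj hw hw' h1 h2 := by
    simp only [Function.update_apply] at hw hw'
    split_ifs at hw hw' with h3 h4
    refine h.undelivered w w' s s' hadj hw hw' ?_ ?_
    · simpa [Heard, Function.update_apply, h3] using h1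
    · simpa [Heard, Function.update_apply, h4] using h2

theorem Invariant.accept {c : Config V τ β} (h : Invariant G H x c) {u v : V} {s : ℝ}
    {y : Option τ} (hu : c.phase u = .connecting v s)
    (hy : IsExchange (c.tokens u) (c.tokens v) y) :
    Invariant G H x
      { c with phase := Function.update c.phase u (.communicating v y c.clock) } where
  tokens := h.tokens
  ads_le := h.ads_le
  ads_tag := h.ads_tag
  nbrs := h.nbrs
  target w w' hw hx := by
    simp only [Function.update_apply] at hw
    split_ifs at hw with h1
    · subst h1
      exact h.target w w' (by simpa [hu, Phase.target] using hw) hx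
    · exact h.target w w' hw hx
  comm w w' z s' hw := by
    simp only [Function.update_apply] at hw
    split_ifs at hw with h1
    · cases hw
      subst h1
      have hz : y = none ∨ y = some x := by
        cases y with
        | none => exact .inl rfl
        | some z =>
          right
          rcases h.tokens w with h2 | h2 <;> rcases h.tokens v with h3 | h3 <;>
            simp_all [IsExchange]
      refine ⟨hz, fun hx => hz.resolve_left ?_⟩
      rintro rfl
      have h2 := h.target w v (by simp [hu, Phase.target]) hx
      rw [IsExchange] at hy
      exact hx (hy ▸ h2)
    · exact h.comm w w' z s' hw
  waiting_le w s hw := by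
    simp only [Function.update_apply] at hw
    split_ifs at hw
    exact h.waiting_le w s hw
  connecting_le w w' s hw := by
    simp only [Function.update_apply] at hw
    split_ifs at hw
    exact h.connecting_le w w' s hw
  communicating_le w w' y s hw := by
    simp only [Function.update_apply] at hw
    split_ifs at hw
    · cases hw; exact le_rfl
    · exact h.communicating_le w w' y s hw
  undelivered w w' s s' hadj hw hw' h1 h2 := by
    simp only [Function.update_apply] at hw hw'
    split_ifs at hw hw' with h3 h4
    exact h.undelivered w w' s s' hadj hw hw' h1 h2

theorem eq_or_mem_of_mem_set {α : Type*} {l : List α} {i : ℕ} {b c : α}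
    (hc : c ∈ l.set i b) : c = b ∨ c ∈ l := by
  rcases List.mem_or_eq_of_mem_set hc with h | h
  · exact .inr h
  · exact .inl h

theorem mem_set_of_mem_of_ne {α : Type*} {l : List α} {i : ℕ} {a b c : α}
    (ha : l[i]? = some a) (hc : c ∈ l) (hne : c ≠ a) : c ∈ l.set i b := by
  obtain ⟨j, hj, rfl⟩ := List.mem_iff_getElem.1 hc
  have hij : i ≠ j := by
    rintro rfl
    rw [List.getElem?_eq_getElem hj, Option.some.injEq] at ha
    exact hne ha
  exact List.mem_iff_getElem.2 ⟨j, by simpa using hj, by rw [List.getElem_set_ne hij]⟩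

theorem self_mem_set {α : Type*} {l : List α} {i : ℕ} {a b : α} (ha : l[i]? = some a) :
    b ∈ l.set i b := by
  obtain ⟨hi, -⟩ := List.getElem?_eq_some_iff.1 ha
  exact List.mem_iff_getElem.2 ⟨i, by simpa using hi, by simp⟩

/-- A delivery changes at most the phase of the receiver, which stays in the same step. -/
theorem Config.phase_deliver (c : Config V τ β) (w : V) (t : ℝ) {v : V} {p : Phase V τ}
    (hp : Function.update c.phase w
      (match c.phase w with
        | .waiting s => .waiting (if Heard c w then s else t)
        | p => p) v = p) :
    c.phase v = p ∨ v = w ∧ ∃ s, c.phase w = .waiting s ∧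
      p = .waiting (if Heard c w then s else t) := by
  by_cases h1 : v = w
  · subst h1
    rw [Function.update_self] at hp
    cases hw : c.phase v with
    | waiting s => rw [hw] at hp; exact .inr ⟨rfl, s, rfl, hp.symm⟩
    | connecting v' s => rw [hw] at hp; exact .inl hp
    | communicating v' y s => rw [hw] at hp; exact .inl hp
  · rw [Function.update_of_ne h1] at hp
    exact .inl hp

theorem Invariant.deliver {c : Config V τ β} (h : Invariant G H x c) {i : ℕ} {w : V} {a : Ad V β}
    (ha : c.ads[i]? = some a) (hadj : G.Adj a.sender w) :
    Invariant G H x { c with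
          nbrs := Function.update c.nbrs w (Function.update (c.nbrs w) a.sender (some a.tag))
          phase := Function.update c.phase w
            (match c.phase w with
              | .waiting s => .waiting (if Heard c w then s else c.clock)
              | p => p)
          ads := c.ads.set i { a with reached := insert w a.reached } } := by
  have ham : a ∈ c.ads := List.mem_of_getElem? ha
  have hphase := fun v p => c.phase_deliver (v := v) w c.clock (p := p)
  exact {
    tokens := h.tokens
    ads_le := fun b hb => by
      rcases eq_or_mem_of_mem_set hb with rfl | hb
      · exact h.ads_le a ham
      · exact h.ads_le b hb
    ads_tag := fun b hb => by
      rcases eq_or_mem_of_mem_set hb with rfl | hb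
      · exact h.ads_tag a ham
      · exact h.ads_tag b hb
    nbrs := fun v v' b hb => by
      simp only [Function.update_apply] at hb
      split_ifs at hb with h1
      · rw [Function.update_apply] at hb
        split_ifs at hb with h2
        · subst h1; subst h2
          cases hb
          exact ⟨hadj, h.ads_tag a ham⟩
        · subst h1
          exact h.nbrs v v' b hb
      · exact h.nbrs v v' b hb
    target := fun v v' hv hx => by
      rcases hphase v _ rfl with h1 | ⟨h1, s, h2, h3⟩
      · exact h.target v v' (by rw [h1]; exact hv) hx
      · dsimp only at hv
        rw [h3] at hv
        simp [Phase.target] at hv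
    comm := fun v v' y s hv => by
      rcases hphase v _ hv with h1 | ⟨h1, s, h2, h3⟩
      · exact h.comm v v' y s h1
      · simp at h3
    waiting_le := fun v s hv => by
      rcases hphase v _ hv with h1 | ⟨h1, s', h2, h3⟩
      · exact h.waiting_le v s h1
      · cases h3
        split_ifs
        · exact h.waiting_le _ _ h2
        · exact le_rfl
    connecting_le := fun v v' s hv => by
      rcases hphase v _ hv with h1 | ⟨h1, s, h2, h3⟩
      · exact h.connecting_le v v' s h1
      · simp at h3
    communicating_le := fun v v' y s hv => by
      rcases hphase v _ hv with h1 | ⟨h1, s, h2, h3⟩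
      · exact h.communicating_le v v' y s h1
      · simp at h3
    undelivered := fun v v' s s' hvv hv hv' h1 h2 => by
      -- The receiver `w` has a nonempty store afterwards, so `w` is neither `v` nor `v'`.
      have hvw : v ≠ w := by
        rintro rfl
        exact h1 ⟨a.sender, by simp⟩
      have hvw' : v' ≠ w := by
        rintro rfl
        exact h2 ⟨a.sender, by simp⟩
      simp only [Function.update_apply, hvw, hvw', if_false] at hv hv'
      obtain ⟨b, hb, hb1, hb2⟩ := h.undelivered v v' s s' hvv hv hv'
        (by simpa [Heard, Function.update_apply, hvw] using h1)
        (by simpa [Heard, Function.update_apply, hvw'] using h2)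
      by_cases hba : b = a
      · subst hba
        exact ⟨_, self_mem_set ha, hb1, by simpa [hvw, hvw'] using hb2⟩
      · exact ⟨b, mem_set_of_mem_of_ne ha hb hba, hb1, hb2⟩ }

theorem Invariant.transition [Fintype V] {c c' : Config V τ β} {m : Move V τ}
    (h : Invariant G H x c)
    (hm : Transition d G H c m c') (ht : c.clock ≤ c'.clock) : Invariant G H x c' := by
  cases hm with
  | idle hu hh hP => exact (h.atTime ht).beginIteration _
  | select hu hv => exact (h.atTime ht).select hv
  | reject hu hb => exact (h.atTime ht).beginIteration _
  | accept hu hb hy => exact (h.atTime ht).accept hu hy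
  | finish hu => exact ((h.atTime ht).exchange (h.comm _ _ _ _ hu).1).beginIteration _
  | deliver ha hadj ht' => exact (h.atTime ht).deliver ha hadj

end Invariant

end AMTM

/-! ### Fresh targets and the exponential supermartingale -/

namespace AMTM

variable {V τ β : Type*}

section Effects

variable [Fintype V] {d : Delays} {G : SimpleGraph V} {H : Finset τ → β}

theorem Transition.ads {c c' : Config V τ β} {m : Move V τ} (h : Transition d G H c m c') :
    ∀ a ∈ c'.ads, (∃ b ∈ c.ads, b.sender = a.sender ∧ b.tag = a.tag ∧ b.sentAt = a.sentAt) ∨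
      a.sentAt = c'.clock ∧ a.tag = H (c'.tokens a.sender) := by
  intro a ha
  cases h with
  | idle hu hh hP =>
    rcases List.mem_append.1 ha with ha | ha
    · exact .inl ⟨a, ha, rfl, rfl, rfl⟩
    · rw [List.mem_singleton.1 ha]; exact .inr ⟨rfl, rfl⟩
  | select hu hv => exact .inl ⟨a, ha, rfl, rfl, rfl⟩
  | reject hu hb =>
    rcases List.mem_append.1 ha with ha | ha
    · exact .inl ⟨a, ha, rfl, rfl, rfl⟩
    · rw [List.mem_singleton.1 ha]; exact .inr ⟨rfl, rfl⟩
  | accept hu hb hy => exact .inl ⟨a, ha, rfl, rfl, rfl⟩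
  | finish hu =>
    rcases List.mem_append.1 ha with ha | ha
    · exact .inl ⟨a, ha, rfl, rfl, rfl⟩
    · rw [List.mem_singleton.1 ha]; exact .inr ⟨rfl, rfl⟩
  | deliver hb hadj ht =>
    rcases eq_or_mem_of_mem_set ha with rfl | ha
    · exact .inl ⟨_, List.mem_of_getElem? hb, rfl, rfl, rfl⟩
    · exact .inl ⟨a, ha, rfl, rfl, rfl⟩

theorem Transition.nbrs {c c' : Config V τ β} {m : Move V τ} (h : Transition d G H c m c')
    {w u : V} {b : β} (hb : c'.nbrs w u = some b) :
    c.nbrs w u = some b ∨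
      ∃ a ∈ c.ads, a.sender = u ∧ a.tag = b ∧ c'.clock ≤ a.sentAt + d.old := by
  cases h with
  | idle hu hh hP => exact .inl hb
  | select hu hv =>
    simp only [Function.update_apply] at hb
    split_ifs at hb
    exact .inl hb
  | reject hu _ => exact .inl hb
  | accept hu _ hy => exact .inl hb
  | finish hu => exact .inl hb
  | deliver ha hadj ht =>
    simp only [Function.update_apply] at hb
    split_ifs at hb with h1
    · rw [Function.update_apply] at hb
      split_ifs at hb with h2
      · exact .inr ⟨_, List.mem_of_getElem? ha, h2.symm, Option.some.inj hb, ht⟩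
      · subst h1; exact .inl hb
    · exact .inl hb

/-- A process acquires a target only by selecting it. -/
theorem Transition.target {c c' : Config V τ β} {m : Move V τ} (h : Transition d G H c m c')
    {v u : V} (hv : (c'.phase v).target = some u) :
    (c.phase v).target = some u ∨
      m = .wake v ∧ u ∈ productive H c v ∧ c'.tokens = c.tokens := by
  cases h with
  | idle hu hh hP =>
    simp only [beginIteration, Function.update_apply] at hv
    split_ifs at hv
    · simp [Phase.target] at hv
    · exact .inl hv
  | select hu hw =>
    simp only [Function.update_apply] at hv
    split_ifs at hv with h1
    · subst h1
      simp only [Phase.target, Option.some.injEq] at hv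
      subst hv
      exact .inr ⟨rfl, hw, rfl⟩
    · exact .inl hv
  | reject hu _ =>
    simp only [beginIteration, Function.update_apply] at hv
    split_ifs at hv
    · simp [Phase.target] at hv
    · exact .inl hv
  | accept hu _ hy =>
    simp only [Function.update_apply] at hv
    split_ifs at hv with h1
    · subst h1
      exact .inl (by simpa [hu, Phase.target] using hv)
    · exact .inl hv
  | finish hu =>
    simp only [beginIteration, Function.update_apply] at hv
    split_ifs at hv
    · simp [Phase.target] at hv
    · exact .inl hv
  | deliver ha hadj ht =>
    rcases c.phase_deliver _ _ (v := v) rfl with h1 | ⟨h1, s, h2, h3⟩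
    · left; rw [h1]; exact hv
    · dsimp only at hv
      rw [h3] at hv
      simp [Phase.target] at hv

/-- A process loses its target by finishing the communication, after which it knows the exchanged
token, or by being rejected in favour of another process. -/
theorem Transition.target_or_waiting {c c' : Config V τ β} {m : Move V τ}
    (h : Transition d G H c m c') {v u : V} (hv : (c.phase v).target = some u) :
    (c'.phase v).target = some u ∨
      (c'.phase v).target = none ∧
        ((∃ y s, c.phase v = .communicating u y s ∧ y.toFinset ⊆ c'.tokens v) ∨
          ∃ w y s, c.phase w = .communicating u y s ∧ c'.phase w = c.phase w) := by
  cases h with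
  | idle hu hh hP =>
    left
    simp only [beginIteration, Function.update_apply]
    split_ifs with h1
    · subst h1; simp [hu, Phase.target] at hv
    · exact hv
  | select hu hw =>
    left
    simp only [Function.update_apply]
    split_ifs with h1
    · subst h1; simp [hu, Phase.target] at hv
    · exact hv
  | @reject r v' y t s hu hb =>
    simp only [beginIteration, Function.update_apply]
    by_cases h1 : v = r
    · subst h1
      right
      simp only [hu, Phase.target, Option.some.injEq] at hv
      subst hv
      obtain ⟨w, y, s', hw⟩ := hb
      have hne : w ≠ v := by
        rintro rfl
        simp [hu] at hw
      exact ⟨by simp [Phase.target], .inr ⟨w, y, s', hw, by simp [hne]⟩⟩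
    · left; simpa [h1] using hv
  | @accept r v' y t s hu _ hy =>
    left
    simp only [Function.update_apply]
    split_ifs with h1
    · subst h1
      simpa [hu, Phase.target] using hv
    · exact hv
  | @finish r v' y t s hu =>
    simp only [beginIteration, Function.update_apply]
    by_cases h1 : v = r
    · subst h1
      right
      simp only [hu, Phase.target, Option.some.injEq] at hv
      subst hv
      exact ⟨by simp [Phase.target], .inl ⟨y, s, hu, by simp⟩⟩
    · left; simpa [h1] using hv
  | deliver ha hadj ht =>
    left
    rcases c.phase_deliver _ _ (v := v) rfl with h1 | ⟨h1, s, h2, h3⟩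
    · exact (congrArg Phase.target h1).symm.trans hv
    · subst h1; simp [h2, Phase.target] at hv

end Effects

section Rank

variable [Fintype V] (d : Delays) (H : Finset τ → β) (x : τ)

/-- The set of processes that know the token `x`. -/
def informed (c : Config V τ β) : Finset V := Finset.univ.filter fun u => x ∈ c.tokens u

/-- An informed process is clean if no process can find its outdated tag, neither in a store nor in
an advertisement that may still be received. -/
structure Clean (c : Config V τ β) (u : V) : Prop where
  mem : x ∈ c.tokens u
  expired : ∀ a ∈ c.ads, a.sender = u → a.tag = H ∅ → a.sentAt + d.old < c.clock
  nbrs : ∀ w, c.nbrs w u ≠ some (H ∅)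

/-- The clean processes that are targeted by uninformed processes only, and by at least one. Each
of them is bound to inform another process. -/
def pulled (c : Config V τ β) : Finset V :=
  Finset.univ.filter fun u => Clean d H x c u ∧
    (∃ v, x ∉ c.tokens v ∧ (c.phase v).target = some u) ∧
    ∀ v, x ∈ c.tokens v → (c.phase v).target ≠ some u

/-- The number of processes that are informed or accounted for by a process bound to inform. -/
def rank (c : Config V τ β) : ℕ := (informed x c).card + (pulled d H x c).card

/-- The productive neighbors of `v` that are clean and not targeted by any process. -/
def freshTargets (c : Config V τ β) (v : V) : Finset V :=
  (productive H c v).filter fun u => Clean d H x c u ∧ ∀ w, (c.phase w).target ≠ some u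

variable {d H x} {G : SimpleGraph V}

theorem mem_informed {c : Config V τ β} {u : V} : u ∈ informed x c ↔ x ∈ c.tokens u := by
  simp [informed]

theorem Transition.informed_subset {c c' : Config V τ β} {m : Move V τ}
    (h : Transition d G H c m c') : informed x c ⊆ informed x c' := fun u hu =>
  mem_informed.2 (h.tokens_subset u (mem_informed.1 hu))

theorem Clean.transition (hH : Function.Injective H) {c c' : Config V τ β} {m : Move V τ} {u : V}
    (hc : Clean d H x c u) (h : Transition d G H c m c') (ht : c.clock ≤ c'.clock) :
    Clean d H x c' u where
  mem := h.tokens_subset u hc.mem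
  expired a ha hau hat := by
    rcases h.ads a ha with ⟨b, hb, h1, h2, h3⟩ | ⟨-, h1⟩
    · rw [← h3]
      exact (hc.expired b hb (h1.trans hau) (h2.trans hat)).trans_le ht
    · have h2 := hH (h1.symm.trans hat)
      have h3 := h.tokens_subset u hc.mem
      rw [← hau, h2] at h3
      simp at h3
  nbrs w hw := by
    rcases h.nbrs hw with h1 | ⟨a, ha, h1, h2, h3⟩
    · exact hc.nbrs w h1
    · exact absurd (hc.expired a ha h1 h2) (by linarith)

theorem Clean.not_mem_productive {c : Config V τ β} {u v : V} (hc : Clean d H x c u)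
    (hI : Invariant G H x c) (hv : x ∈ c.tokens v) : u ∉ productive H c v := by
  simp only [productive, Finset.mem_filter, Finset.mem_univ, true_and]
  rintro ⟨b, hb, hne⟩
  rw [hI.tokens_eq_singleton hv] at hne
  rcases (hI.nbrs v u b hb).2 with rfl | ⟨rfl, -⟩
  · exact hc.nbrs v hb
  · exact hne rfl

theorem mem_pulled {c : Config V τ β} {u : V} : u ∈ pulled d H x c ↔ Clean d H x c u ∧
    (∃ v, x ∉ c.tokens v ∧ (c.phase v).target = some u) ∧
    ∀ v, x ∈ c.tokens v → (c.phase v).target ≠ some u := by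
  simp [pulled]

/-- A process ceases to be bound to inform another one only if a process that targets it becomes
informed: an uninformed process is rejected only in favour of another one, which remains, and no
informed process selects a clean one. -/
theorem mem_pulled_of_transition (hH : Function.Injective H) {c c' : Config V τ β} {m : Move V τ}
    (hI : Invariant G H x c) (h : Transition d G H c m c') (ht : c.clock ≤ c'.clock) {u : V}
    (hu : u ∈ pulled d H x c)
    (hnew : ∀ w, x ∉ c.tokens w → x ∈ c'.tokens w → (c.phase w).target ≠ some u) :
    u ∈ pulled d H x c' := by
  rw [mem_pulled] at hu ⊢
  obtain ⟨hc, ⟨v, hv, hvu⟩, hno⟩ := hu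
  refine ⟨hc.transition hH h ht, ?_, fun w hw hwu => ?_⟩
  · rcases h.target_or_waiting hvu with h1 | ⟨-, ⟨y, s, h1, h2⟩ | ⟨w, y, s, h1, h2⟩⟩
    · exact ⟨v, fun h2 => hnew v hv h2 hvu, h1⟩
    · rw [(hI.comm v u y s h1).2 hv] at h2
      exact absurd hvu (hnew v hv (h2 (by simp)))
    · have h3 : (c.phase w).target = some u := by rw [h1]; rfl
      have h4 : x ∉ c.tokens w := fun h4 => hno w h4 h3
      exact ⟨w, fun h5 => hnew w h4 h5 h3, by rw [h2, h3]⟩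
  · rcases h.target hwu with h1 | ⟨-, h1, h2⟩
    · by_cases hw' : x ∈ c.tokens w
      · exact hno w hw' h1
      · exact hnew w hw' hw h1
    · rw [h2] at hw
      exact hc.not_mem_productive hI hw h1

/-- Each process that leaves `pulled` can be charged to a newly informed process that targeted it, and
a process has only one target. -/
theorem rank_le_of_transition (hH : Function.Injective H) {c c' : Config V τ β} {m : Move V τ}
    (hI : Invariant G H x c) (h : Transition d G H c m c') (ht : c.clock ≤ c'.clock) :
    rank d H x c ≤ rank d H x c' := by
  have h1 : (pulled d H x c \ pulled d H x c').card ≤ (informed x c' \ informed x c).card := by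
    rw [← Finset.card_map Function.Embedding.some]
    refine (Finset.card_le_card ?_).trans
      (Finset.card_image_le (s := informed x c' \ informed x c) (f := fun w => (c.phase w).target))
    intro o ho
    obtain ⟨u, hu, rfl⟩ := Finset.mem_map.1 ho
    rw [Finset.mem_sdiff] at hu
    by_contra hcon
    refine hu.2 (mem_pulled_of_transition hH hI h ht hu.1 fun w hw hw' hwu => hcon ?_)
    exact Finset.mem_image.2 ⟨w, by simp [mem_informed, hw, hw'], hwu⟩
  have h2 : (pulled d H x c).card ≤ (pulled d H x c \ pulled d H x c').card +
      (pulled d H x c').card := Finset.card_le_card_sdiff_add_card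
  have h3 := Finset.card_sdiff_add_card_eq_card (h.informed_subset (x := x))
  unfold rank
  omega

/-- A hit increases the rank. -/
theorem rank_lt_of_select (hH : Function.Injective H) {c c' : Config V τ β} {u v : V}
    (hI : Invariant G H x c) (h : Transition d G H c (.wake v) c') (ht : c.clock ≤ c'.clock)
    (hv : x ∉ c.tokens v) (htok : c'.tokens = c.tokens) (hu : u ∈ freshTargets d H x c v)
    (hvu : (c'.phase v).target = some u) :
    rank d H x c + 1 ≤ rank d H x c' := by
  simp only [freshTargets, Finset.mem_filter] at hu
  have h1 : u ∉ pulled d H x c := fun h1 => by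
    obtain ⟨w, -, hw⟩ := (mem_pulled.1 h1).2.1
    exact hu.2.2 w hw
  have h2 : insert u (pulled d H x c) ⊆ pulled d H x c' := by
    intro w hw
    rcases Finset.mem_insert.1 hw with rfl | hw
    · refine mem_pulled.2 ⟨hu.2.1.transition hH h ht, ⟨v, by rwa [htok], hvu⟩, fun z hz hzw => ?_⟩
      rcases h.target hzw with h2 | ⟨h2, -, -⟩
      · exact hu.2.2 z h2
      · cases h2
        rw [htok] at hz
        exact hv hz
    · refine mem_pulled_of_transition hH hI h ht hw fun z hz hz' => ?_
      rw [htok] at hz'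
      exact absurd hz' hz
  have h3 := Finset.card_le_card h2
  rw [Finset.card_insert_of_notMem h1] at h3
  have h4 : informed x c' = informed x c := by simp [informed, htok]
  unfold rank
  rw [h4]
  omega

theorem rank_le_card (c : Config V τ β) :
    rank d H x c ≤ Fintype.card V := by
  have h1 : (pulled d H x c).card ≤ (informed x c)ᶜ.card := by
    rw [← Finset.card_map Function.Embedding.some]
    refine (Finset.card_le_card ?_).trans
      (Finset.card_image_le (s := (informed x c)ᶜ) (f := fun w => (c.phase w).target))
    intro o ho
    obtain ⟨u, hu, rfl⟩ := Finset.mem_map.1 ho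
    obtain ⟨v, hv, hvu⟩ := (mem_pulled.1 hu).2.1
    exact Finset.mem_image.2 ⟨v, by simp [mem_informed, hv], hvu⟩
  have h2 := Finset.card_add_card_compl (informed x c)
  unfold rank
  omega

theorem rank_le_two_mul (c : Config V τ β) : rank d H x c ≤ 2 * (informed x c).card := by
  have h1 : (pulled d H x c).card ≤ (informed x c).card :=
    Finset.card_le_card fun u hu => mem_informed.2 (mem_pulled.1 hu).1.mem
  unfold rank
  omega

theorem card_informed_le_rank (c : Config V τ β) : (informed x c).card ≤ rank d H x c :=
  Nat.le_add_right _ _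

end Rank

section Tail

open scoped ENNReal

theorem _root_.PMF.tsum_bind_mul {α γ : Type*} (p : PMF α) (f : α → PMF γ) (g : γ → ℝ≥0∞) :
    ∑' b, (p.bind f) b * g b = ∑' a, p a * ∑' b, f a b * g b := by
  simp only [PMF.bind_apply, ← ENNReal.tsum_mul_right, ← ENNReal.tsum_mul_left]
  rw [ENNReal.tsum_comm]
  simp only [mul_assoc]

theorem _root_.PMF.tsum_map_mul {α γ : Type*} (p : PMF α) (f : α → γ) (g : γ → ℝ≥0∞) :
    ∑' b, (p.map f) b * g b = ∑' a, p a * g (f a) := by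
  rw [← PMF.bind_pure_comp, PMF.tsum_bind_mul]
  refine tsum_congr fun a => ?_
  congr 1
  rw [tsum_eq_single (f a)]
  · simp
  · intro b hb; simp [hb]

theorem _root_.PMF.tsum_mul_le {α : Type*} (p : PMF α) (f : α → ℝ≥0∞) (B : ℝ≥0∞)
    (h : ∀ a ∈ p.support, f a ≤ B) : ∑' a, p a * f a ≤ B := by
  calc ∑' a, p a * f a ≤ ∑' a, p a * B := by
        refine ENNReal.tsum_le_tsum fun a => ?_
        by_cases ha : a ∈ p.support
        · gcongr; exact h a ha
        · simp [(PMF.apply_eq_zero_iff p a).2 ha]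
    _ = B := by rw [ENNReal.tsum_mul_right, p.tsum_coe, one_mul]

variable [Fintype V] (d : Delays) (H : Finset τ → β) (x : τ) (α : ℝ)

/-- The conditional expectation, given the configuration `c` and the next event, of the weight
gained by a selection that hits a fresh target. Only selections by uninformed processes count. -/
def pullRate (c : Config V τ β) : Move V τ → ℝ
  | .wake v => if x ∈ c.tokens v then 0 else
      spreadWeight α (Fintype.card V) (rank d H x c) *
        ((freshTargets d H x c v).card / (productive H c v).card)
  | _ => 0

/-- The sum of the rates over all steps of the execution. -/
def totalRate (σ : Scheduler V τ β) : List (Config V τ β) → Config V τ β → ℝ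
  | [], _ => 0
  | c :: l, _ => totalRate σ l c + pullRate d H x α c (σ (l, c)).2

variable {d H x α} {G : SimpleGraph V}

theorem pullRate_nonneg (c : Config V τ β) (m : Move V τ) : 0 ≤ pullRate d H x α c m := by
  cases m with
  | wake v =>
    rw [pullRate]
    split_ifs
    · exact le_rfl
    · have := spreadWeight_pos α (Fintype.card V) (rank d H x c)
      positivity
  | _ => exact le_rfl

theorem one_sub_mul_one_sub_exp_neg_le_exp {p w : ℝ} (hp : 0 ≤ p) (hw0 : 0 ≤ w) (hw : w ≤ 1) :
    1 - p * (1 - Real.exp (-w)) ≤ Real.exp (-(w * p) / 2) := by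
  have h1 : Real.exp (-w) ≤ 1 - w / 2 := by
    have h2 := Real.add_one_le_exp w
    have h3 : Real.exp (-w) * Real.exp w = 1 := by rw [← Real.exp_add]; simp
    have h4 := Real.exp_pos (-w)
    nlinarith
  have h2 := Real.add_one_le_exp (-(w * p) / 2)
  nlinarith

/-- The configuration after `v` has selected `u` at time `t`. -/
abbrev Config.select (c : Config V τ β) (t : ℝ) (v u : V) : Config V τ β :=
  { c.atTime t with
    nbrs := Function.update c.nbrs v fun _ => none
    phase := Function.update c.phase v (.connecting u t) }

/-- The exponential supermartingale, for one step: a selection by an uninformed process increases the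
rank with the probability that enters `pullRate`, and no step decreases it. -/
theorem tsum_step_le (hH : Function.Injective H) {c : Config V τ β} {t : ℝ} {m : Move V τ}
    (hI : Invariant G H x c) (ht : c.clock ≤ t) (hm : Enabled d G c t m) :
    ∑' c', step H c t m c' *
        ENNReal.ofReal (Real.exp (-spreadPotential α (Fintype.card V) (rank d H x c'))) ≤
      ENNReal.ofReal (Real.exp (-spreadPotential α (Fintype.card V) (rank d H x c) -
        pullRate d H x α c m / 2)) := by
  have hmono := spreadPotential_mono α (Fintype.card V)
  have hrank : ∀ c' ∈ (step H c t m).support, rank d H x c ≤ rank d H x c' := fun c' hc' => by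
    obtain ⟨h1, h2⟩ := transition_of_mem_support hm hc'
    exact rank_le_of_transition hH hI h1 (by rw [h2]; exact ht)
  have hzero : pullRate d H x α c m = 0 → ∑' c', step H c t m c' *
        ENNReal.ofReal (Real.exp (-spreadPotential α (Fintype.card V) (rank d H x c'))) ≤
      ENNReal.ofReal (Real.exp (-spreadPotential α (Fintype.card V) (rank d H x c) -
        pullRate d H x α c m / 2)) := fun h0 => by
    refine PMF.tsum_mul_le _ _ _ fun c' hc' => ?_
    rw [h0]
    have := hmono (hrank c' hc')
    exact ENNReal.ofReal_le_ofReal (Real.exp_le_exp.2 (by linarith))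
  by_cases hsel : ∃ v, m = .wake v ∧ x ∉ c.tokens v ∧ (productive H c v).Nonempty
  swap
  · apply hzero
    cases m with
    | wake v =>
      rw [pullRate]
      split_ifs with h1
      · rfl
      · have h2 : productive H c v = ∅ := by
          by_contra h2
          exact hsel ⟨v, rfl, h1, Finset.nonempty_iff_ne_empty.2 h2⟩
        simp [h2]
    | _ => rfl
  obtain ⟨v, rfl, hv, hP⟩ := hsel
  obtain ⟨⟨s, hs⟩, -⟩ := id hm
  have hstep : step H c t (.wake v) =
      (PMF.uniformOfFinset (productive H c v) hP).map (c.select t v) := by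
    simp only [step, effect]
    exact dif_pos hP
  set P := productive H c v with hPdef
  set Q := freshTargets d H x c v with hQdef
  set Ψ := spreadPotential α (Fintype.card V) (rank d H x c) with hΨ
  set w := spreadWeight α (Fintype.card V) (rank d H x c) with hw
  have hQP : Q ⊆ P := Finset.filter_subset _ _
  have hPpos : (0 : ℝ) < P.card := by exact_mod_cast hP.card_pos
  rw [hstep, PMF.tsum_map_mul, tsum_fintype]
  have hbound : ∀ u, PMF.uniformOfFinset P hP u * ENNReal.ofReal (Real.exp
      (-spreadPotential α (Fintype.card V) (rank d H x (c.select t v u)))) ≤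
      ENNReal.ofReal (if u ∈ P then
        (P.card : ℝ)⁻¹ * (Real.exp (-Ψ) * if u ∈ Q then Real.exp (-w) else 1) else 0) := by
    intro u
    rw [PMF.uniformOfFinset_apply]
    split_ifs with huP huQ
    · have h1 := rank_lt_of_select hH hI
        (Transition.select hs huP : Transition d G H c (.wake v) (c.select t v u)) ht hv rfl huQ
        (by simp [Phase.target])
      have h2 := hmono h1
      rw [spreadPotential, Finset.sum_range_succ] at h2
      rw [ENNReal.ofReal_mul (by positivity), ENNReal.ofReal_inv_of_pos hPpos,
        ENNReal.ofReal_natCast, ← Real.exp_add]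
      gcongr
      have h3 : Ψ + w ≤ _ := h2
      linarith
    · have h1 := hrank (c.select t v u) (by
        rw [hstep, PMF.support_map]
        exact ⟨u, by simpa using huP, rfl⟩)
      have h2 := hmono h1
      rw [ENNReal.ofReal_mul (by positivity), ENNReal.ofReal_inv_of_pos hPpos,
        ENNReal.ofReal_natCast, mul_one]
      gcongr
    · simp
  refine (Finset.sum_le_sum fun u _ => hbound u).trans ?_
  rw [← ENNReal.ofReal_sum_of_nonneg fun u _ => by positivity]
  apply ENNReal.ofReal_le_ofReal
  have hsum : ∑ u, (if u ∈ P then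
        (P.card : ℝ)⁻¹ * (Real.exp (-Ψ) * if u ∈ Q then Real.exp (-w) else 1) else 0) =
      Real.exp (-Ψ) * (1 - Q.card / P.card * (1 - Real.exp (-w))) := by
    rw [← Finset.sum_filter, Finset.filter_mem_eq_inter, Finset.univ_inter, ← Finset.mul_sum,
      ← Finset.mul_sum]
    have h1 : ∑ u ∈ P, (if u ∈ Q then Real.exp (-w) else 1) =
        P.card - Q.card * (1 - Real.exp (-w)) := by
      have h2 : ∀ u ∈ P, (if u ∈ Q then Real.exp (-w) else (1 : ℝ)) =
          1 - if u ∈ Q then 1 - Real.exp (-w) else 0 := fun u _ => by split_ifs <;> ring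
      rw [Finset.sum_congr rfl h2, Finset.sum_sub_distrib, ← Finset.sum_filter,
        Finset.filter_mem_eq_inter, Finset.inter_eq_right.2 hQP]
      simp [mul_sub]
    rw [h1]
    field_simp
  have hrate : pullRate d H x α c (.wake v) = w * (Q.card / P.card) := by
    rw [pullRate, if_neg hv]
  rw [hsum, hrate, sub_eq_add_neg (-Ψ), Real.exp_add, ← neg_div]
  exact mul_le_mul_of_nonneg_left (one_sub_mul_one_sub_exp_neg_le_exp (by positivity)
    (spreadWeight_pos _ _ _).le (spreadWeight_le_one _ _ _)) (Real.exp_pos _).le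

variable {start : V → Finset τ} {σ : Scheduler V τ β}

theorem mem_support_run_succ {N : ℕ} {h : History V τ β}
    (hh : h ∈ (run H start σ (N + 1)).support) : ∃ h' ∈ (run H start σ N).support,
      ∃ c ∈ (step H h'.2 (σ h').1 (σ h').2).support, h = (h'.2 :: h'.1, c) := by
  simp only [run, PMF.mem_support_bind_iff, PMF.support_map, Set.mem_image] at hh
  obtain ⟨h', hh', c, hc, rfl⟩ := hh
  exact ⟨h', hh', c, hc, rfl⟩

theorem invariant_of_mem_support (hs : ∀ u, start u = ∅ ∨ start u = {x})
    (hσ : Admissible d G H start σ) (N : ℕ) :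
    ∀ h ∈ (run H start σ N).support, Invariant G H x h.2 := by
  induction N with
  | zero =>
    intro h hh
    rw [run, PMF.mem_support_pure_iff] at hh
    subst hh
    exact invariant_initialConfig hs
  | succ N ih =>
    intro h hh
    obtain ⟨h', hh', c, hc, rfl⟩ := mem_support_run_succ hh
    obtain ⟨h1, h2⟩ := transition_of_mem_support (hσ.enabled N h' hh') hc
    exact (ih h' hh').transition h1 (by rw [h2]; exact (hσ.timeOK N h' hh').clock_le)

/-- The expectation of the exponential supermartingale is at most one. -/
theorem tsum_run_le_one (hH : Function.Injective H) (hs : ∀ u, start u = ∅ ∨ start u = {x})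
    (hσ : Admissible d G H start σ) (N : ℕ) :
    ∑' h, run H start σ N h * ENNReal.ofReal (Real.exp (totalRate d H x α σ h.1 h.2 / 2 -
      spreadPotential α (Fintype.card V) (rank d H x h.2))) ≤ 1 := by
  induction N with
  | zero =>
    refine PMF.tsum_mul_le _ _ _ fun h hh => ?_
    rw [run, PMF.mem_support_pure_iff] at hh
    subst hh
    rw [ENNReal.ofReal_le_one, Real.exp_le_one_iff, totalRate]
    have := spreadPotential_nonneg α (Fintype.card V)
      (rank d H x (initialConfig (V := V) H start))
    dsimp only
    linarith
  | succ N ih =>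
    rw [run, PMF.tsum_bind_mul]
    refine le_trans (ENNReal.tsum_le_tsum fun h => ?_) ih
    by_cases hh : h ∈ (run H start σ N).support
    swap
    · simp [(PMF.apply_eq_zero_iff _ h).2 hh]
    gcongr
    rw [PMF.tsum_map_mul]
    have h1 := tsum_step_le (α := α) hH (invariant_of_mem_support hs hσ N h hh)
      (hσ.timeOK N h hh).clock_le (hσ.enabled N h hh)
    set A := totalRate d H x α σ h.1 h.2 with hA
    set r := pullRate d H x α h.2 (σ h).2 with hr
    have h2 : ∀ c, totalRate d H x α σ (h.2 :: h.1) c = A + r := fun c => rfl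
    simp only [h2]
    calc ∑' c, step H h.2 (σ h).1 (σ h).2 c * ENNReal.ofReal (Real.exp ((A + r) / 2 -
          spreadPotential α (Fintype.card V) (rank d H x c)))
        = ENNReal.ofReal (Real.exp ((A + r) / 2)) * ∑' c, step H h.2 (σ h).1 (σ h).2 c *
          ENNReal.ofReal (Real.exp (-spreadPotential α (Fintype.card V) (rank d H x c))) := by
          rw [← ENNReal.tsum_mul_left]
          refine tsum_congr fun c => ?_
          rw [sub_eq_add_neg, Real.exp_add, ENNReal.ofReal_mul (Real.exp_pos _).le]
          ring
      _ ≤ ENNReal.ofReal (Real.exp ((A + r) / 2)) * ENNReal.ofReal (Real.exp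
          (-spreadPotential α (Fintype.card V) (rank d H x h.2) - r / 2)) := by gcongr
      _ = _ := by
          rw [← ENNReal.ofReal_mul (Real.exp_pos _).le, ← Real.exp_add]
          congr 2
          ring

/-- Markov's inequality: the total rate is unlikely to exceed twice the largest value of the potential
by far. -/
theorem toOuterMeasure_totalRate_le (hH : Function.Injective H)
    (hs : ∀ u, start u = ∅ ∨ start u = {x}) (hσ : Admissible d G H start σ) (N : ℕ) (B : ℝ) :
    (run H start σ N).toOuterMeasure {h | B ≤ totalRate d H x α σ h.1 h.2} ≤
      ENNReal.ofReal (Real.exp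
        (spreadPotential α (Fintype.card V) (Fintype.card V) - B / 2)) := by
  set Ψ := spreadPotential α (Fintype.card V) (Fintype.card V) with hΨ
  rw [PMF.toOuterMeasure_apply]
  calc ∑' h, Set.indicator {h | B ≤ totalRate d H x α σ h.1 h.2} (run H start σ N) h
      ≤ ∑' h, ENNReal.ofReal (Real.exp (Ψ - B / 2)) * (run H start σ N h *
        ENNReal.ofReal (Real.exp (totalRate d H x α σ h.1 h.2 / 2 -
          spreadPotential α (Fintype.card V) (rank d H x h.2)))) := by
        refine ENNReal.tsum_le_tsum fun h => ?_
        by_cases hB : B ≤ totalRate d H x α σ h.1 h.2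
        · rw [Set.indicator_of_mem (by exact hB), mul_left_comm,
            ← ENNReal.ofReal_mul (Real.exp_pos _).le, ← Real.exp_add]
          refine le_mul_of_one_le_right' ?_
          rw [ENNReal.one_le_ofReal, Real.one_le_exp_iff]
          have := spreadPotential_mono α (Fintype.card V)
            (rank_le_card (d := d) (H := H) (x := x) h.2)
          linarith
        · rw [Set.indicator_of_notMem (by exact hB)]
          exact bot_le
    _ ≤ _ := by
        rw [ENNReal.tsum_mul_left]
        exact mul_le_of_le_one_right' (tsum_run_le_one hH hs hσ N)

end Tail

end AMTM

/-! ### Progress within bounded time -/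

namespace AMTM

variable {V τ β : Type*}

section Progress

variable {d : Delays} {G : SimpleGraph V} {H : Finset τ → β}

/-- Process `u` has just sent its current tag, and nobody has received it yet. -/
def Announced (H : Finset τ → β) (c : Config V τ β) (u : V) : Prop :=
  ∃ a ∈ c.ads, a.sender = u ∧ a.tag = H (c.tokens u) ∧ a.sentAt = c.clock ∧ a.reached = ∅

/-- Process `u` is waiting and its store is empty. -/
def Stalled (c : Config V τ β) (u : V) : Prop := (c.phase u).target = none ∧ ¬ Heard c u

/-- An advertisement of `u` with tag `b`, sent by time `r`, is still to be delivered to `w`. -/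
def Pending (c : Config V τ β) (u w : V) (b : β) (r : ℝ) : Prop :=
  ∃ a ∈ c.ads, a.sender = u ∧ a.tag = b ∧ a.sentAt ≤ r ∧ w ∉ a.reached

/-- The time by which a process in this phase gives up its target. For a waiting process it is the
time from which the delay of its next selection counts, so that the release time never increases
between two selections of a process with a nonempty store. -/
def Phase.releaseTime (d : Delays) : Phase V τ → ℝ
  | .waiting s => s
  | .connecting _ s => s + d.connect + d.comm
  | .communicating _ _ s => s + d.comm

theorem Phase.exists_waiting {p : Phase V τ} (h : p.target = none) : ∃ s, p = .waiting s := by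
  cases p with
  | waiting s => exact ⟨s, rfl⟩
  | _ => simp [Phase.target] at h

theorem announced_beginIteration (c : Config V τ β) (u : V) :
    Announced H (beginIteration H c u) u :=
  ⟨_, List.mem_append_right _ (List.mem_singleton_self _), rfl, rfl, rfl, rfl⟩

theorem Announced.pending {c : Config V τ β} {u : V} (h : Announced H c u) (w : V) :
    Pending c u w (H (c.tokens u)) c.clock := by
  obtain ⟨a, ha, h1, h2, h3, h4⟩ := h
  exact ⟨a, ha, h1, h2, h3.le, by simp [h4]⟩

theorem Transition.target_or_announced [Fintype V] {c c' : Config V τ β} {m : Move V τ}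
    (h : Transition d G H c m c') {v u : V} (hv : (c.phase v).target = some u) :
    (c'.phase v).target = some u ∨ Announced H c' v := by
  rcases h.target_or_waiting hv with h1 | ⟨h1, -⟩
  · exact .inl h1
  right
  cases h with
  | @idle r t s hu hh hP =>
    by_cases hr : v = r
    · subst hr; exact announced_beginIteration _ _
    · simp [beginIteration, hr, hv] at h1
  | @select r w t s hu hw =>
    by_cases hr : v = r
    · subst hr; simp [Phase.target] at h1
    · simp [hr, hv] at h1
  | @reject r w y t s hu hb =>
    by_cases hr : v = r
    · subst hr; exact announced_beginIteration _ _
    · simp [beginIteration, hr, hv] at h1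
  | @accept r w y t s hu hb hy =>
    by_cases hr : v = r
    · subst hr; simp [Phase.target] at h1
    · simp [hr, hv] at h1
  | @finish r w y t s hu =>
    by_cases hr : v = r
    · subst hr; exact announced_beginIteration _ _
    · simp [beginIteration, hr, hv] at h1
  | @deliver i w a t ha hadj ht =>
    by_cases hr : v = w
    · subst hr
      cases hp : c.phase v <;> simp_all [Phase.target]
    · simp [hr, hv] at h1

theorem Transition.announced_or_target_of_wake [Fintype V] {c c' : Config V τ β} {u : V}
    (h : Transition d G H c (.wake u) c') :
    Announced H c' u ∨ ∃ v, (c'.phase u).target = some v := by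
  cases h with
  | idle hu hh hP => exact .inl (announced_beginIteration _ _)
  | select hu hv => exact .inr ⟨_, by simp [Phase.target]; rfl⟩

theorem Transition.heard [Fintype V] {c c' : Config V τ β} {m : Move V τ}
    (h : Transition d G H c m c')
    {v : V} (hm : m ≠ .wake v) (hv : Heard c v) : Heard c' v := by
  cases h with
  | idle hu hh hP => exact hv
  | select hu hw =>
    have : v ≠ _ := fun h => hm (congrArg Move.wake h.symm)
    simpa [Heard, this] using hv
  | reject hu _ => exact hv
  | accept hu _ hy => exact hv
  | finish hu => exact hv
  | @deliver i w a t ha hadj ht =>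
    by_cases hw : v = w
    · subst hw; exact ⟨a.sender, by simp⟩
    · simpa [Heard, hw] using hv

theorem Transition.releaseTime_le_of_target [Fintype V] {c c' : Config V τ β} {m : Move V τ}
    (h : Transition d G H c m c') (ht : TimeOK d G c c'.clock) {v u : V}
    (hv : (c.phase v).target = some u) :
    (c'.phase v).releaseTime d ≤ (c.phase v).releaseTime d := by
  have h0 := d.comm_nonneg
  have h0' := d.connect_nonneg
  cases h with
  | @idle r t s hu hh hP =>
    by_cases hr : v = r
    · subst hr; simp [hu, Phase.target] at hv
    · simp [beginIteration, hr]
  | @select r w t s hu hw =>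
    by_cases hr : v = r
    · subst hr; simp [hu, Phase.target] at hv
    · simp [hr]
  | @reject r w y t s hu hb =>
    by_cases hr : v = r
    · subst hr
      have := ht.connecting_le _ _ _ hu
      simp only [beginIteration, Function.update_self, Phase.releaseTime, hu] at this ⊢
      linarith
    · simp [beginIteration, hr]
  | @accept r w y t s hu hb hy =>
    by_cases hr : v = r
    · subst hr
      have := ht.connecting_le _ _ _ hu
      simp only [Function.update_self, Phase.releaseTime, hu] at this ⊢
      linarith
    · simp [hr]
  | @finish r w y t s hu =>
    by_cases hr : v = r
    · subst hr
      have := ht.communicating_le _ _ _ _ hu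
      simp only [beginIteration, Function.update_self, Phase.releaseTime, hu] at this ⊢
      linarith
    · simp [beginIteration, hr]
  | deliver ha hadj ht =>
    rcases c.phase_deliver _ _ (v := v) rfl with h2 | ⟨h2, s, h3, h4⟩
    · exact (congrArg (Phase.releaseTime d) h2).ge
    · subst h2; simp [h3, Phase.target] at hv

theorem Transition.releaseTime_le [Fintype V] {c c' : Config V τ β} {m : Move V τ}
    (h : Transition d G H c m c') (ht : TimeOK d G c c'.clock) {v : V}
    (hv : Heard c v) (hm : m ≠ .wake v) :
    (c'.phase v).releaseTime d ≤ (c.phase v).releaseTime d := by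
  cases hp : (c.phase v).target with
  | some u => exact h.releaseTime_le_of_target ht hp
  | none =>
    obtain ⟨s₀, hs₀⟩ := Phase.exists_waiting hp
    cases h with
    | @idle r t s hu hh hP =>
      have hr : v ≠ r := fun h => hm (congrArg Move.wake h.symm)
      simp [beginIteration, hr]
    | @select r w t s hu hw =>
      have hr : v ≠ r := fun h => hm (congrArg Move.wake h.symm)
      simp [hr]
    | @reject r w y t s hu hb =>
      have hr : v ≠ r := by rintro rfl; simp [hs₀] at hu
      simp [beginIteration, hr]
    | @accept r w y t s hu hb hy =>
      have hr : v ≠ r := by rintro rfl; simp [hs₀] at hu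
      simp [hr]
    | @finish r w y t s hu =>
      have hr : v ≠ r := by rintro rfl; simp [hs₀] at hu
      simp [beginIteration, hr]
    | @deliver i w a t ha hadj ht =>
      by_cases hr : v = w
      · subst hr; simp [hs₀, hv]
      · simp [hr]

theorem clock_le_releaseTime {c : Config V τ β} {t : ℝ} (ht : TimeOK d G c t) {v u : V}
    (hv : (c.phase v).target = some u) : t ≤ (c.phase v).releaseTime d := by
  have h0 := d.comm_nonneg
  cases hp : c.phase v with
  | waiting s => simp [hp, Phase.target] at hv
  | connecting w s => have := ht.connecting_le _ _ _ hp; simp only [Phase.releaseTime]; linarith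
  | communicating w y s => exact ht.communicating_le _ _ _ _ hp

theorem clock_le_releaseTime_add {c : Config V τ β} {t : ℝ} (ht : TimeOK d G c t) {v : V}
    (hv : Heard c v) : t ≤ (c.phase v).releaseTime d + d.update := by
  have h0 := d.update_pos
  cases hp : (c.phase v).target with
  | some u => linarith [clock_le_releaseTime ht hp]
  | none =>
    obtain ⟨s, hs⟩ := Phase.exists_waiting hp
    rw [hs]
    exact ht.waiting_le _ _ hs hv

theorem Invariant.releaseTime_le {x : τ} {c : Config V τ β} (h : Invariant G H x c) (v : V) :
    (c.phase v).releaseTime d ≤ c.clock + d.connect + d.comm := by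
  have h0 := d.comm_nonneg
  have h0' := d.connect_nonneg
  cases hp : c.phase v with
  | waiting s => have := h.waiting_le _ _ hp; simp only [Phase.releaseTime]; linarith
  | connecting w s => have := h.connecting_le _ _ _ hp; simp only [Phase.releaseTime]; linarith
  | communicating w y s =>
    have := h.communicating_le _ _ _ _ hp; simp only [Phase.releaseTime]; linarith

theorem Stalled.transition [Fintype V] {c c' : Config V τ β} {m : Move V τ} {u : V}
    (hu : Stalled c u) (h : Transition d G H c m c') (hu' : Stalled c' u) : c'.phase u = c.phase u := by
  cases h with
  | @idle r t s h1 hh hP =>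
    have hr : u ≠ r := fun h => hu.2 (h ▸ hh)
    simp [beginIteration, hr]
  | @select r w t s h1 hw =>
    have hr : u ≠ r := by rintro rfl; simp [Stalled, Phase.target] at hu'
    simp [hr]
  | @reject r w y t s h1 hb =>
    have hr : u ≠ r := by rintro rfl; simp [Stalled, h1, Phase.target] at hu
    simp [beginIteration, hr]
  | @accept r w y t s h1 hb hy =>
    have hr : u ≠ r := by rintro rfl; simp [Stalled, h1, Phase.target] at hu
    simp [hr]
  | @finish r w y t s h1 =>
    have hr : u ≠ r := by rintro rfl; simp [Stalled, h1, Phase.target] at hu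
    simp [beginIteration, hr]
  | @deliver i w a t ha hadj ht =>
    have hr : u ≠ w := by rintro rfl; exact hu'.2 ⟨a.sender, by simp⟩
    simp [hr]

theorem Pending.transition [Fintype V] {c c' : Config V τ β} {m : Move V τ} {u w : V} {b : β}
    {r : ℝ} (hp : Pending c u w b r) (h : Transition d G H c m c') :
    Pending c' u w b r ∨ c'.nbrs w u = some b := by
  obtain ⟨a, ha, h1, h2, h3, h4⟩ := hp
  cases h with
  | idle hu hh hP => exact .inl ⟨a, List.mem_append_left _ ha, h1, h2, h3, h4⟩
  | select hu hw => exact .inl ⟨a, ha, h1, h2, h3, h4⟩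
  | reject hu _ => exact .inl ⟨a, List.mem_append_left _ ha, h1, h2, h3, h4⟩
  | accept hu _ hy => exact .inl ⟨a, ha, h1, h2, h3, h4⟩
  | finish hu => exact .inl ⟨a, List.mem_append_left _ ha, h1, h2, h3, h4⟩
  | @deliver i v a' t ha' hadj ht =>
    by_cases haa : a = a'
    · subst haa
      by_cases hv : w = v
      · subst hv; subst h1; subst h2
        right; simp
      · exact .inl ⟨_, self_mem_set ha', h1, h2, h3, by simp [hv, h4]⟩
    · exact .inl ⟨a, mem_set_of_mem_of_ne ha' ha haa, h1, h2, h3, h4⟩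

theorem Transition.nbrs_ne_none [Fintype V] {c c' : Config V τ β} {m : Move V τ}
    (h : Transition d G H c m c') {v u : V} (hm : m ≠ .wake v) (hv : c.nbrs v u ≠ none) :
    c'.nbrs v u ≠ none := by
  cases h with
  | @select r w t s hu hw =>
    have : v ≠ r := fun h => hm (congrArg Move.wake h.symm)
    simpa [this] using hv
  | @deliver i w a t ha hadj ht =>
    simp only [Function.update_apply]
    split_ifs with h1
    · rw [Function.update_apply]
      split_ifs
      · simp
      · exact h1 ▸ hv
    · exact hv
  | _ => exact hv

theorem Transition.communicating [Fintype V] {c c' : Config V τ β} {m : Move V τ}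
    (h : Transition d G H c m c') {v u : V} {y : Option τ} {s : ℝ}
    (hv : c.phase v = .communicating u y s) (hv' : (c'.phase v).target ≠ none) :
    c'.phase v = .communicating u y s := by
  cases h with
  | @idle r t s h1 hh hP =>
    have hr : v ≠ r := by rintro rfl; simp [hv] at h1
    simp [beginIteration, hr, hv]
  | @select r w t s h1 hw =>
    have hr : v ≠ r := by rintro rfl; simp [hv] at h1
    simp [hr, hv]
  | @reject r w y t s h1 hb =>
    have hr : v ≠ r := by rintro rfl; simp [hv] at h1
    simp [beginIteration, hr, hv]
  | @accept r w y t s h1 hb hy =>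
    have hr : v ≠ r := by rintro rfl; simp [hv] at h1
    simp [hr, hv]
  | @finish r w y t s h1 =>
    have hr : v ≠ r := by rintro rfl; simp [beginIteration, Phase.target] at hv'
    simp [beginIteration, hr, hv]
  | @deliver i w a t ha hadj ht =>
    by_cases hr : v = w
    · subst hr; simp [hv]
    · simp [hr, hv]

theorem Transition.tokens_of_communicating [Fintype V] {c c' : Config V τ β} {m : Move V τ}
    (h : Transition d G H c m c') {v u : V} {y : Option τ} {s : ℝ}
    (hv : c.phase v = .communicating u y s) (hv' : (c'.phase v).target ≠ some u) :
    y.toFinset ⊆ c'.tokens v := by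
  by_cases hn : (c'.phase v).target = none
  swap
  · rw [h.communicating hv hn] at hv'
    exact absurd rfl hv'
  cases h with
  | @finish r w y t s h1 =>
    by_cases hr : v = r
    · subst hr
      rw [hv] at h1
      cases h1
      simp [beginIteration]
    · simp [beginIteration, hr, hv, Phase.target] at hn
  | @idle r t s h1 hh hP =>
    have hr : v ≠ r := by rintro rfl; simp [hv] at h1
    simp [beginIteration, hr, hv, Phase.target] at hn
  | @select r w t s h1 hw =>
    have hr : v ≠ r := by rintro rfl; simp [hv] at h1
    simp [hr, hv, Phase.target] at hn
  | @reject r w y t s h1 hb =>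
    have hr : v ≠ r := by rintro rfl; simp [hv] at h1
    simp [beginIteration, hr, hv, Phase.target] at hn
  | @accept r w y t s h1 hb hy =>
    have hr : v ≠ r := by rintro rfl; simp [hv] at h1
    simp [hr, hv, Phase.target] at hn
  | @deliver i w a t ha hadj ht =>
    by_cases hr : v = w
    · subst hr; simp [hv, Phase.target] at hn
    · simp [hr, hv, Phase.target] at hn

end Progress

/-- An infinite execution, given by its configurations and events. -/
structure Execution [Fintype V] (d : Delays) (G : SimpleGraph V) (H : Finset τ → β) (x : τ)
    (e : ℕ → Config V τ β) (m : ℕ → Move V τ) : Prop where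
  invariant : ∀ i, Invariant G H x (e i)
  timeOK : ∀ i, TimeOK d G (e i) (e (i + 1)).clock
  transition : ∀ i, Transition d G H (e i) (m i) (e (i + 1))
  unbounded : ∀ T, ∃ i, T < (e i).clock

theorem exists_step_of_not {P : ℕ → Prop} {i k : ℕ} (hik : i ≤ k) (hi : ¬ P i) (hk : P k) :
    ∃ j, i ≤ j ∧ j < k ∧ ¬ P j ∧ P (j + 1) := by
  induction k, hik using Nat.le_induction with
  | base => exact absurd hk hi
  | succ k hk' ih =>
    by_cases h : P k
    · obtain ⟨j, h1, h2, h3⟩ := ih h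
      exact ⟨j, h1, by omega, h3⟩
    · exact ⟨k, hk', by omega, h, hk⟩

namespace Execution

variable [Fintype V] {d : Delays} {G : SimpleGraph V} {H : Finset τ → β} {x : τ}
  {e : ℕ → Config V τ β} {m : ℕ → Move V τ}

theorem clock_mono (E : Execution d G H x e m) {i j : ℕ} (h : i ≤ j) :
    (e i).clock ≤ (e j).clock :=
  monotone_nat_of_le_succ (f := fun i => (e i).clock) (fun i => (E.timeOK i).clock_le) h

theorem informed_mono (E : Execution d G H x e m) {i j : ℕ} (h : i ≤ j) :
    informed x (e i) ⊆ informed x (e j) :=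
  monotone_nat_of_le_succ (f := fun i => informed x (e i))
    (fun i => (E.transition i).informed_subset) h

theorem tokens_mono (E : Execution d G H x e m) {i j : ℕ} (h : i ≤ j) {u : V}
    (hu : x ∈ (e i).tokens u) : x ∈ (e j).tokens u :=
  mem_informed.1 (E.informed_mono h (mem_informed.2 hu))

theorem clean_mono (E : Execution d G H x e m) (hH : Function.Injective H) {i j : ℕ} (h : i ≤ j)
    {u : V} (hu : Clean d H x (e i) u) : Clean d H x (e j) u := by
  induction j, h using Nat.le_induction with
  | base => exact hu
  | succ k hk ih => exact ih.transition hH (E.transition k) (E.timeOK k).clock_le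

/-- Since time diverges, a condition that forces a deadline while it lasts ends by the deadline. -/
theorem exists_exit (E : Execution d G H x e m) (P : ℕ → Prop) {i : ℕ} (hi : P i) {B : ℝ}
    (hB : ∀ k, i ≤ k → (∀ j, i ≤ j → j ≤ k → P j) → (e (k + 1)).clock ≤ B) :
    ∃ k, i ≤ k ∧ (∀ j, i ≤ j → j ≤ k → P j) ∧ ¬ P (k + 1) ∧ (e (k + 1)).clock ≤ B := by
  by_contra! hcon
  have hall : ∀ k, i ≤ k → ∀ j, i ≤ j → j ≤ k → P j := by
    intro k hk
    induction k, hk using Nat.le_induction with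
    | base => intro j h1 h2; rwa [show j = i by omega]
    | succ k hk ih =>
      intro j h1 h2
      rcases Nat.lt_or_ge k j with h3 | h3
      · rw [show j = k + 1 by omega]
        by_contra hn
        exact absurd (hB k hk ih) (not_le.2 (hcon k hk ih hn))
      · exact ih j h1 h3
  obtain ⟨N, hN⟩ := E.unbounded B
  have h1 := hB (max i N) (le_max_left _ _) (hall _ (le_max_left _ _))
  have h2 := E.clock_mono (show N ≤ max i N + 1 from (le_max_right _ _).trans (Nat.le_succ _))
  linarith

/-- A targeting process keeps its target until it starts the next iteration. -/
theorem exists_release (E : Execution d G H x e m) {i : ℕ} {v u : V}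
    (hv : ((e i).phase v).target = some u) :
    ∃ k, i ≤ k ∧ (∀ j, i ≤ j → j ≤ k → ((e j).phase v).target = some u) ∧
      ((e (k + 1)).phase v).target ≠ some u ∧ Announced H (e (k + 1)) v ∧
      (e (k + 1)).clock ≤ (e i).clock + d.connect + d.comm := by
  obtain ⟨k, hk, h1, h2, h3⟩ := E.exists_exit (fun j => ((e j).phase v).target = some u) hv
    (B := (e i).clock + d.connect + d.comm) fun k hk hall => by
      have h1 : ((e k).phase v).releaseTime d ≤ ((e i).phase v).releaseTime d := by
        induction k, hk using Nat.le_induction with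
        | base => exact le_rfl
        | succ k hk ih =>
          exact ((E.transition k).releaseTime_le_of_target (E.timeOK k)
            (hall k hk (Nat.le_succ k))).trans (ih fun j h1 h2 => hall j h1 (by omega))
      exact (clock_le_releaseTime (E.timeOK k) (hall k hk le_rfl)).trans
        (h1.trans ((E.invariant i).releaseTime_le v))
  exact ⟨k, hk, h1, h2,
    ((E.transition k).target_or_announced (h1 k hk le_rfl)).resolve_left h2, h3⟩

theorem clock_le_of_target (E : Execution d G H x e m) {i k : ℕ} (hik : i ≤ k) {v u : V}
    (hv : ∀ j, i ≤ j → j ≤ k → ((e j).phase v).target = some u) :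
    (e k).clock ≤ (e i).clock + d.connect + d.comm := by
  obtain ⟨k', hk', h1, h2, -, h3⟩ := E.exists_release (hv i le_rfl hik)
  refine (E.clock_mono ?_).trans h3
  by_contra hlt
  exact h2 (hv (k' + 1) (by omega) (by omega))

/-- A process with a nonempty store selects within `d.max`, whatever it is doing. -/
theorem exists_wake (E : Execution d G H x e m) {i : ℕ} {v : V} (hv : Heard (e i) v) :
    ∃ k, i ≤ k ∧ (∀ j, i ≤ j → j < k → m j ≠ .wake v) ∧ m k = .wake v ∧
      (e (k + 1)).clock ≤ (e i).clock + d.max := by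
  obtain ⟨k, hk, h1, h2, h3⟩ := E.exists_exit (fun k => ∀ j, i ≤ j → j < k → m j ≠ .wake v)
    (i := i) (by intro j h1 h2; omega) (B := (e i).clock + d.max) fun k hk hall => by
      have h1 : Heard (e k) v ∧
          ((e k).phase v).releaseTime d ≤ ((e i).phase v).releaseTime d := by
        induction k, hk using Nat.le_induction with
        | base => exact ⟨hv, le_rfl⟩
        | succ k hk ih =>
          obtain ⟨h2, h3⟩ := ih fun j h1 h2 => hall j h1 (by omega)
          have h4 := hall (k + 1) (by omega) le_rfl k hk (Nat.lt_succ_self k)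
          exact ⟨(E.transition k).heard h4 h2,
            ((E.transition k).releaseTime_le (E.timeOK k) h2 h4).trans h3⟩
      have h2 := clock_le_releaseTime_add (E.timeOK k) h1.1
      have h3 := (E.invariant i).releaseTime_le (d := d) v
      unfold Delays.max
      linarith [h1.2]
  refine ⟨k, hk, fun j => h1 k hk le_rfl j, ?_, h3⟩
  by_contra hne
  refine h2 fun j hj hjk => ?_
  rcases Nat.lt_or_ge j k with h4 | h4
  · exact h1 k hk le_rfl j hj h4
  · rwa [show j = k by omega]

theorem exists_delivered (E : Execution d G H x e m) {i : ℕ} {u w : V} {b : β} {r : ℝ}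
    (huw : G.Adj u w) (hp : Pending (e i) u w b r) :
    ∃ k, i ≤ k ∧ (e k).nbrs w u = some b ∧ (e k).clock ≤ r + d.update := by
  obtain ⟨k, hk, h1, h2, h3⟩ := E.exists_exit (fun j => Pending (e j) u w b r) hp
    (B := r + d.update) fun k hk hall => by
      obtain ⟨a, ha, h1, h2, h3, h4⟩ := hall k hk le_rfl
      have := (E.timeOK k).ads_le a ha w (h1 ▸ huw) h4
      linarith
  exact ⟨k + 1, by omega, ((h1 k hk le_rfl).transition (E.transition k)).resolve_left h2, h3⟩

end Execution

theorem Delays.max_pos (d : Delays) : 0 < d.max := by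
  have h1 := d.update_pos
  have h2 := d.connect_nonneg
  have h3 := d.comm_nonneg
  unfold Delays.max; linarith

theorem Delays.update_le_max (d : Delays) : d.update ≤ d.max := by
  have h2 := d.connect_nonneg
  have h3 := d.comm_nonneg
  unfold Delays.max; linarith

theorem Delays.connect_add_comm_le_max (d : Delays) : d.connect + d.comm ≤ d.max := by
  have h1 := d.update_pos
  unfold Delays.max; linarith

namespace Execution

variable [Fintype V] {d : Delays} {G : SimpleGraph V} {H : Finset τ → β} {x : τ}
  {e : ℕ → Config V τ β} {m : ℕ → Move V τ}

theorem exists_announced_of_not_stalled (E : Execution d G H x e m) {i : ℕ} {u : V}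
    (hu : ¬ Stalled (e i) u) :
    ∃ k, i ≤ k ∧ Announced H (e k) u ∧ (e k).clock ≤ (e i).clock + 2 * d.max := by
  have h0 := d.connect_add_comm_le_max
  have h0' := d.max_pos
  by_cases ht : ((e i).phase u).target = none
  · have hh : Heard (e i) u := by
      by_contra hh; exact hu ⟨ht, hh⟩
    obtain ⟨k, hk, -, hw, hc⟩ := E.exists_wake hh
    rcases (hw ▸ E.transition k).announced_or_target_of_wake with h1 | ⟨v, h1⟩
    · exact ⟨k + 1, by omega, h1, by linarith⟩
    · obtain ⟨k', hk', -, -, h2, h3⟩ := E.exists_release h1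
      exact ⟨k' + 1, by omega, h2, by linarith⟩
  · obtain ⟨v, hv⟩ := Option.ne_none_iff_exists'.1 ht
    obtain ⟨k, hk, -, -, h1, h2⟩ := E.exists_release hv
    exact ⟨k + 1, by omega, h1, by linarith⟩

/-- Two neighbors cannot both stay stalled: one has an advertisement to be delivered to the other. -/
theorem exists_not_stalled (E : Execution d G H x e m) {i : ℕ} {u w : V} (huw : G.Adj u w) :
    ∃ k, i ≤ k ∧ (¬ Stalled (e k) u ∨ ¬ Stalled (e k) w) ∧
      (e k).clock ≤ (e i).clock + d.max := by
  have h0' := d.max_pos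
  by_cases hs : Stalled (e i) u ∧ Stalled (e i) w
  swap
  · exact ⟨i, le_rfl, not_and_or.1 hs, by linarith⟩
  obtain ⟨k, hk, h1, h2, h3⟩ := E.exists_exit (fun j => Stalled (e j) u ∧ Stalled (e j) w) hs
    (B := (e i).clock + d.max) fun k hk hall => by
      obtain ⟨s, hsu⟩ := Phase.exists_waiting hs.1.1
      obtain ⟨s', hsw⟩ := Phase.exists_waiting hs.2.1
      have h1 : (e k).phase u = .waiting s ∧ (e k).phase w = .waiting s' := by
        induction k, hk using Nat.le_induction with
        | base => exact ⟨hsu, hsw⟩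
        | succ k hk ih =>
          obtain ⟨h2, h3⟩ := ih fun j h1 h2 => hall j h1 (by omega)
          obtain ⟨h4, h5⟩ := hall k hk (Nat.le_succ k)
          obtain ⟨h6, h7⟩ := hall (k + 1) (by omega) le_rfl
          exact ⟨(h4.transition (E.transition k) h6).trans h2,
            (h5.transition (E.transition k) h7).trans h3⟩
      obtain ⟨h2, h3⟩ := hall k hk le_rfl
      obtain ⟨a, ha, h4, h5⟩ := (E.invariant k).undelivered u w s s' huw h1.1 h1.2 h2.2 h3.2
      have h6 : (e (k + 1)).clock ≤ a.sentAt + d.update := by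
        rcases h5 with ⟨rfl, h5⟩ | ⟨rfl, h5⟩
        · exact (E.timeOK k).ads_le a ha w huw h5
        · exact (E.timeOK k).ads_le a ha u huw.symm h5
      have h7 := max_le ((E.invariant i).waiting_le u s hsu) ((E.invariant i).waiting_le w s' hsw)
      have h8 := d.update_le_max
      linarith
  exact ⟨k + 1, by omega, not_and_or.1 h2, h3⟩

/-- Every process starts a new iteration again and again, within bounded time. -/
theorem exists_announced (E : Execution d G H x e m) (hG : ∀ u, ∃ w, G.Adj u w) (i : ℕ) (u : V) :
    ∃ k, i ≤ k ∧ Announced H (e k) u ∧ (e k).clock ≤ (e i).clock + 6 * d.max := by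
  have h0 := d.update_le_max
  have h0' := d.max_pos
  obtain ⟨w, huw⟩ := hG u
  obtain ⟨k, hk, h1, h2⟩ := E.exists_not_stalled (i := i) huw
  rcases h1 with h1 | h1
  · obtain ⟨k', hk', h3, h4⟩ := E.exists_announced_of_not_stalled h1
    exact ⟨k', by omega, h3, by linarith⟩
  · obtain ⟨k', hk', h3, h4⟩ := E.exists_announced_of_not_stalled h1
    obtain ⟨k₂, hk₂, h5, h6⟩ := E.exists_delivered huw.symm (h3.pending u)
    obtain ⟨k₃, hk₃, h7, h8⟩ := E.exists_announced_of_not_stalled (i := k₂) (u := u)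
      fun hs => hs.2 ⟨w, by simp [h5]⟩
    exact ⟨k₃, by omega, h7, by linarith⟩

theorem clock_succ_le (E : Execution d G H x e m) (hG : ∀ u, ∃ w, G.Adj u w) [Nonempty V]
    (i : ℕ) : (e (i + 1)).clock ≤ (e i).clock + 6 * d.max := by
  have h0 := d.update_le_max
  have h0' := d.max_pos
  obtain ⟨u⟩ := ‹Nonempty V›
  obtain ⟨k, hk, h1, h2⟩ := E.exists_announced hG i u
  rcases hk.eq_or_lt with rfl | hk
  · obtain ⟨w, huw⟩ := hG u
    obtain ⟨a, ha, rfl, h3, h4, h5⟩ := h1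
    have := (E.timeOK i).ads_le a ha w huw (by simp [h5])
    linarith
  · exact (E.clock_mono hk).trans h2

theorem exists_index_gt (E : Execution d G H x e m) (hG : ∀ u, ∃ w, G.Adj u w) [Nonempty V]
    {i : ℕ} {r : ℝ} (hr : (e i).clock ≤ r) :
    ∃ k, i ≤ k ∧ r < (e k).clock ∧ (e k).clock ≤ r + 6 * d.max := by
  obtain ⟨k, hk, h1, h2, h3⟩ := E.exists_exit (fun j => (e j).clock ≤ r) hr
    (B := r + 6 * d.max) fun k hk hall => by
      have := E.clock_succ_le hG k
      have := hall k hk le_rfl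
      linarith
  exact ⟨k + 1, by omega, not_le.1 h2, h3⟩

/-- An informed process makes its new tag known to each neighbor within bounded time. -/
theorem exists_recorded (E : Execution d G H x e m) (hG : ∀ u, ∃ w, G.Adj u w) {i : ℕ} {u w : V}
    (hu : x ∈ (e i).tokens u) (huw : G.Adj u w) :
    ∃ k, i ≤ k ∧ (e k).nbrs w u = some (H {x}) ∧ (e k).clock ≤ (e i).clock + 7 * d.max := by
  have h0 := d.update_le_max
  obtain ⟨k, hk, h1, h2⟩ := E.exists_announced hG i u
  have h3 := h1.pending w
  rw [(E.invariant k).tokens_eq_singleton (E.tokens_mono hk hu)] at h3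
  obtain ⟨k', hk', h4, h5⟩ := E.exists_delivered huw h3
  exact ⟨k', by omega, h4, by linarith⟩

/-- An advertisement with the outdated tag was sent before its sender became informed. -/
theorem expired (E : Execution d G H x e m) (hH : Function.Injective H) {i j : ℕ} (hij : i ≤ j)
    {u : V} (hu : x ∈ (e i).tokens u) :
    ∀ a ∈ (e j).ads, a.sender = u → a.tag = H ∅ → a.sentAt ≤ (e i).clock := by
  induction j, hij using Nat.le_induction with
  | base => exact fun a ha _ _ => (E.invariant i).ads_le a ha
  | succ k hk ih =>
    intro a ha hau hat
    rcases (E.transition k).ads a ha with ⟨b, hb, h1, h2, h3⟩ | ⟨-, h1⟩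
    · rw [← h3]
      exact ih b hb (h1.trans hau) (h2.trans hat)
    · have h2 := hH (h1.symm.trans hat)
      have h3 := E.tokens_mono (show i ≤ k + 1 by omega) hu
      rw [← hau, h2] at h3
      simp at h3

/-- Once an informed process has been so for long enough, all traces of its old tag are gone. -/
theorem clean_of_lt (E : Execution d G H x e m) (hH : Function.Injective H)
    (hG : ∀ u, ∃ w, G.Adj u w) {i j : ℕ} {u : V} (hu : x ∈ (e i).tokens u)
    (hj : (e i).clock + d.old + 13 * d.max < (e j).clock) : Clean d H x (e j) u := by
  have hne : Nonempty V := ⟨u⟩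
  have h0 := d.max_pos
  have h0' := d.update_pos
  have h0'' := d.update_lt_old
  obtain ⟨k, hik, hk1, hk2⟩ := E.exists_index_gt hG (i := i) (r := (e i).clock + d.old)
    (by linarith)
  have hexp : ∀ l, k ≤ l → ∀ a ∈ (e l).ads, a.sender = u → a.tag = H ∅ →
      a.sentAt + d.old < (e l).clock := fun l hl a ha hau hat => by
    have h1 := E.expired hH (hik.trans hl) hu a ha hau hat
    have h2 := E.clock_mono hl
    linarith
  have hkj : k ≤ j := by
    by_contra hlt
    have := E.clock_mono (show j ≤ k by omega)
    linarith
  refine ⟨E.tokens_mono (hik.trans hkj) hu, hexp j hkj, fun w hw => ?_⟩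
  have huw := ((E.invariant j).nbrs w u _ hw).1
  obtain ⟨l, hkl, h1, h2⟩ := E.exists_recorded hG (E.tokens_mono hik hu) huw
  have hlj : l ≤ j := by
    by_contra hlt
    have := E.clock_mono (show j ≤ l by omega)
    linarith
  have h3 : (e j).nbrs w u ≠ some (H ∅) := by
    clear hw hj hkj
    induction j, hlj using Nat.le_induction with
    | base =>
      rw [h1]
      intro h
      simpa using hH (Option.some.inj h)
    | succ j hj ih =>
      intro h
      rcases (E.transition j).nbrs h with h | ⟨a, ha, h4, h5, h6⟩
      · exact ih h
      · have h7 := hexp j (hkl.trans hj) a ha h4 h5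
        have h8 := (E.timeOK j).clock_le
        linarith
  exact h3 hw

/-- A clean process is soon among the productive neighbors from which an uninformed neighbor
selects at random. -/
theorem exists_wake_of_clean (E : Execution d G H x e m) (hH : Function.Injective H)
    (hG : ∀ u, ∃ w, G.Adj u w) {i j : ℕ} {u v : V} (hu : Clean d H x (e i) u) (huv : G.Adj u v)
    (hj : (e i).clock + 8 * d.max < (e j).clock) (hv : x ∉ (e j).tokens v) :
    ∃ k, i ≤ k ∧ k < j ∧ m k = .wake v ∧ u ∈ productive H (e k) v := by
  obtain ⟨k, hik, h1, h2⟩ := E.exists_recorded hG hu.mem huv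
  obtain ⟨l, hkl, h3, h4, h5⟩ := E.exists_wake (i := k) (v := v) ⟨u, by simp [h1]⟩
  have hlj : l < j := by
    by_contra hlt
    have := E.clock_mono (show j ≤ l + 1 by omega)
    linarith
  refine ⟨l, by omega, hlj, h4, ?_⟩
  have h6 : (e l).nbrs v u = some (H {x}) := by
    clear h4 h5 hlj
    induction l, hkl using Nat.le_induction with
    | base => exact h1
    | succ l hl ih =>
      have h7 := ih fun j hj hjl => h3 j hj (by omega)
      have h8 := h3 l hl (Nat.lt_succ_self l)
      have h9 : Heard (e (l + 1)) v := (E.transition l).heard h8 ⟨u, by simp [h7]⟩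
      have hcl := E.clean_mono hH (show i ≤ l by omega) hu
      have hcl' := E.clean_mono hH (show i ≤ l + 1 by omega) hu
      have h10 : (e (l + 1)).nbrs v u ≠ none := (E.transition l).nbrs_ne_none h8 (by simp [h7])
      obtain ⟨b, hb⟩ := Option.ne_none_iff_exists'.1 h10
      rcases ((E.invariant (l + 1)).nbrs v u b hb).2 with h | ⟨h, -⟩
      · exact absurd (h ▸ hb) (hcl'.nbrs v)
      · exact h ▸ hb
  simp only [productive, Finset.mem_filter, Finset.mem_univ, true_and]
  refine ⟨_, h6, ?_⟩
  rw [(E.invariant l).tokens_eq_empty fun h => hv (E.tokens_mono hlj.le h)]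
  intro h
  simpa using hH h

/-- An informed process that targets a process that has been clean for long enough was informed
while it had this target, because informed processes select no clean ones. -/
theorem exists_informed_step_of_informed (E : Execution d G H x e m) (hH : Function.Injective H)
    {i k : ℕ} {u v : V} (hu : Clean d H x (e i) u) (hv : x ∈ (e k).tokens v)
    (hvu : ((e k).phase v).target = some u)
    (hk : (e i).clock + d.connect + d.comm < (e k).clock) :
    ∃ j, i ≤ j ∧ j < k ∧ ((e j).phase v).target = some u ∧ x ∉ (e j).tokens v ∧
      x ∈ (e (j + 1)).tokens v := by
  by_contra! hcon
  have hik : i ≤ k := by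
    by_contra hlt
    have := E.clock_mono (show k ≤ i by omega)
    have := d.connect_nonneg
    have := d.comm_nonneg
    linarith
  have hall : ∀ l, l ≤ k - i → x ∈ (e (k - l)).tokens v ∧
      ((e (k - l)).phase v).target = some u := by
    intro l
    induction l with
    | zero => exact fun _ => ⟨hv, hvu⟩
    | succ l ih =>
      intro hl
      obtain ⟨h1, h2⟩ := ih (by omega)
      have hstep : k - l = k - (l + 1) + 1 := by omega
      rw [hstep] at h1 h2
      set j := k - (l + 1) with hj
      rcases (E.transition j).target h2 with h3 | ⟨-, h3, h4⟩
      · by_cases h5 : x ∈ (e j).tokens v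
        · exact ⟨h5, h3⟩
        · exact absurd h1 (hcon j (by omega) (by omega) h3 h5)
      · rw [h4] at h1
        exact absurd h3 ((E.clean_mono hH (by omega) hu).not_mem_productive (E.invariant j) h1)
  have := E.clock_le_of_target hik (v := v) (u := u) fun j h1 h2 => by
    have h3 := (hall (k - j) (by omega)).2
    rwa [show k - (k - j) = j by omega] at h3
  linarith

/-- Whenever a process `u` that has been clean for long enough is targeted by some `v`, a process with
the target `u` becomes informed around that time: `v` itself or the process in favour of which `v` is
rejected. -/
theorem exists_informed_step_of_target (E : Execution d G H x e m) (hH : Function.Injective H)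
    {i k l : ℕ} {u v : V} (hu : Clean d H x (e i) u) (hvu : ((e k).phase v).target = some u)
    (hk : (e i).clock + d.connect + d.comm < (e k).clock)
    (hl : (e k).clock + 2 * d.max < (e l).clock) :
    ∃ w j, i ≤ j ∧ j < l ∧ ((e j).phase w).target = some u ∧ x ∉ (e j).tokens w ∧
      x ∈ (e (j + 1)).tokens w := by
  have h0 := d.connect_add_comm_le_max
  have h0' := d.max_pos
  have h01 := d.connect_nonneg
  have h02 := d.comm_nonneg
  have hlt : ∀ j, (e j).clock < (e l).clock → j < l := fun j hj => by
    by_contra hlt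
    have := E.clock_mono (show l ≤ j by omega)
    linarith
  have hik : i ≤ k := by
    by_contra hlt
    have := E.clock_mono (show k ≤ i by omega)
    linarith
  by_cases hv : x ∈ (e k).tokens v
  · obtain ⟨j, h1, h2, h3⟩ := E.exists_informed_step_of_informed hH hu hv hvu hk
    exact ⟨v, j, h1, h2.trans (hlt k (by linarith)), h3⟩
  obtain ⟨k₁, hk₁, h1, h2, -, h3⟩ := E.exists_release hvu
  by_cases hv₁ : x ∈ (e (k₁ + 1)).tokens v
  · obtain ⟨j, h4, h5, h6, h7⟩ := exists_step_of_not (P := fun j => x ∈ (e j).tokens _)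
      (by omega) hv hv₁
    have := hlt (k₁ + 1) (by linarith)
    exact ⟨v, j, by omega, by omega, h1 j h4 (by omega), h6, h7⟩
  rcases (E.transition k₁).target_or_waiting (h1 k₁ hk₁ le_rfl) with
    h4 | ⟨-, ⟨y, s, h4, h5⟩ | ⟨w, y, s, h4, -⟩⟩
  · exact absurd h4 h2
  · rw [((E.invariant k₁).comm v u y s h4).2 fun h =>
      hv₁ (E.tokens_mono (Nat.le_succ k₁) h)] at h5
    exact absurd (h5 (by simp)) hv₁
  -- The process was rejected in favour of `w`.
  have hwu : ((e k₁).phase w).target = some u := by rw [h4]; rfl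
  have hk₁' := E.clock_mono (Nat.le_succ k₁)
  have hkk := E.clock_mono hk₁
  by_cases hw : x ∈ (e k₁).tokens w
  · obtain ⟨j, h5, h6, h7⟩ := E.exists_informed_step_of_informed hH hu hw hwu (by linarith)
    exact ⟨w, j, h5, h6.trans (hlt k₁ (by linarith)), h7⟩
  obtain ⟨k₂, hk₂, h5, h6, -, h7⟩ := E.exists_release hwu
  have hk₂l := hlt (k₂ + 1) (by linarith)
  have h8 : ∀ j, k₁ ≤ j → j ≤ k₂ → ∃ y s, (e j).phase w = .communicating u y s := by
    intro j hj
    induction j, hj using Nat.le_induction with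
    | base => exact fun _ => ⟨y, s, h4⟩
    | succ j hj ih =>
      intro hj2
      obtain ⟨y', s', h9⟩ := ih (by omega)
      exact ⟨y', s', (E.transition j).communicating h9 (by rw [h5 (j + 1) (by omega) hj2]; simp)⟩
  obtain ⟨y', s', h9⟩ := h8 k₂ hk₂ le_rfl
  have hw₂ : x ∈ (e (k₂ + 1)).tokens w := by
    by_contra hn
    have hn' : x ∉ (e k₂).tokens w := fun h => hn (E.tokens_mono (Nat.le_succ k₂) h)
    have h10 := (E.transition k₂).tokens_of_communicating h9 h6
    rw [((E.invariant k₂).comm w u y' s' h9).2 hn'] at h10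
    exact hn (h10 (by simp))
  obtain ⟨j, h10, h11, h12, h13⟩ := exists_step_of_not (P := fun j => x ∈ (e j).tokens _)
      (by omega) hw hw₂
  exact ⟨w, j, by omega, by omega, h5 j h10 (by omega), h12, h13⟩

end Execution

end AMTM

/-! ### The total rate grows while some process is uninformed -/

/-- If each node `v` outside a set `S` and its newly informed part `F` pulls from a random one of
its `D v` neighbors in `S \ T` or of at most `2 g` others, then the expected number of hits in
`S \ T` is bounded below by the size of a vertex cover of the cut. Nodes with `D v > 2 g` hit with
probability at least one half; the others are joined to the cover through their neighbors. -/
theorem cover_le_sum_hit_probability {V : Type*} [Fintype V] (G : SimpleGraph V)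
    {S T F : Finset V} {g : ℕ} {κ : ℝ} (hT : T.card ≤ g) (hF : F.card ≤ g)
    (hκ : ∀ C : Finset V, (∀ u ∈ S, ∀ v ∉ S, G.Adj u v → u ∈ C ∨ v ∈ C) → κ ≤ C.card)
    (D : V → ℕ) (hD : ∀ v, D v = ((S \ T).filter fun u => G.Adj u v).card) :
    (κ - 2 * g) / (4 * g + 2) ≤ ∑ v ∈ (S ∪ F)ᶜ, (D v : ℝ) / (D v + 2 * g) := by
  set U := (S ∪ F)ᶜ with hU
  set W := U.filter fun v => 2 * g < D v with hW
  set U' := U.filter fun v => ¬ 2 * g < D v with hU'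
  set B := U'.biUnion fun v => (S \ T).filter fun u => G.Adj u v with hB
  have hcover : κ ≤ (T ∪ F ∪ W ∪ B).card := by
    refine hκ _ fun u hu v hv huv => ?_
    by_cases huT : u ∈ T
    · left; simp [huT]
    by_cases hvF : v ∈ F
    · right; simp [hvF]
    have hvU : v ∈ U := by simp [hU, hv, hvF]
    by_cases hvW : 2 * g < D v
    · right
      have : v ∈ W := Finset.mem_filter.2 ⟨hvU, hvW⟩
      simp [this]
    · left
      have : u ∈ B := Finset.mem_biUnion.2 ⟨v, Finset.mem_filter.2 ⟨hvU, hvW⟩,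
        Finset.mem_filter.2 ⟨Finset.mem_sdiff.2 ⟨hu, huT⟩, huv⟩⟩
      simp [this]
  have hcard : (T ∪ F ∪ W ∪ B).card ≤ 2 * g + W.card + ∑ v ∈ U', D v := by
    have h1 : B.card ≤ ∑ v ∈ U', D v :=
      Finset.card_biUnion_le.trans_eq (Finset.sum_congr rfl fun v _ => (hD v).symm)
    have h2 := Finset.card_union_le (T ∪ F ∪ W) B
    have h3 := Finset.card_union_le (T ∪ F) W
    have h4 := Finset.card_union_le T F
    omega
  have hcard' : κ ≤ 2 * g + W.card + ∑ v ∈ U', (D v : ℝ) := by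
    refine hcover.trans ?_
    exact_mod_cast hcard
  have hg : (0 : ℝ) ≤ g := by positivity
  rw [← Finset.sum_filter_add_sum_filter_not U (fun v => 2 * g < D v)]
  have h1 : (W.card : ℝ) / (4 * g + 2) ≤ ∑ v ∈ W, (D v : ℝ) / (D v + 2 * g) := by
    rw [div_eq_mul_one_div, ← nsmul_eq_mul]
    refine Finset.card_nsmul_le_sum _ _ _ fun v hv => ?_
    have h2 : (2 * g + 1 : ℝ) ≤ D v := by exact_mod_cast (Finset.mem_filter.1 hv).2
    rw [div_le_div_iff₀ (by positivity) (by linarith)]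
    nlinarith
  have h2 : (∑ v ∈ U', (D v : ℝ)) / (4 * g + 2) ≤ ∑ v ∈ U', (D v : ℝ) / (D v + 2 * g) := by
    rw [Finset.sum_div]
    refine Finset.sum_le_sum fun v hv => ?_
    have h2 : (D v : ℝ) ≤ 2 * g := by exact_mod_cast not_lt.1 (Finset.mem_filter.1 hv).2
    rcases Nat.eq_zero_or_pos (D v) with h3 | h3
    · simp [h3]
    · have h4 : (0 : ℝ) < D v := by exact_mod_cast h3
      exact div_le_div_of_nonneg_left h4.le (by linarith) (by linarith)
  calc (κ - 2 * g) / (4 * g + 2) ≤ (W.card + ∑ v ∈ U', (D v : ℝ)) / (4 * g + 2) := by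
        gcongr; linarith
    _ ≤ _ := by rw [add_div]; exact add_le_add h1 h2

namespace AMTM

variable {V τ β : Type*}

namespace Execution

variable [Fintype V] {d : Delays} {G : SimpleGraph V} {H : Finset τ → β} {x : τ}
  {e : ℕ → Config V τ β} {m : ℕ → Move V τ}

/-- Distinct targets that are clean and targeted during a period belong to distinct processes that
become informed, since a process has one target at the moment at which it becomes informed. -/
theorem card_targeted_le (E : Execution d G H x e m) (hH : Function.Injective H)
    {i₀ i₁ i₂ i₃ i₄ : ℕ} (h01 : i₀ ≤ i₁) (hclean : ∀ u ∈ informed x (e i₀), Clean d H x (e i₁) u)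
    (h2 : (e i₁).clock + d.max < (e i₂).clock) (h4 : (e i₃).clock + 2 * d.max < (e i₄).clock) :
    ((informed x (e i₀)).filter fun u =>
      ∃ j, i₂ ≤ j ∧ j < i₃ ∧ ∃ v, ((e j).phase v).target = some u).card ≤
    (informed x (e i₄) \ informed x (e i₀)).card := by
  have h0 := d.connect_add_comm_le_max
  have key : ∀ u : V, ∃ w j, u ∈ ((informed x (e i₀)).filter fun u =>
      ∃ j, i₂ ≤ j ∧ j < i₃ ∧ ∃ v, ((e j).phase v).target = some u) →
      i₁ ≤ j ∧ j < i₄ ∧ ((e j).phase w).target = some u ∧ x ∉ (e j).tokens w ∧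
        x ∈ (e (j + 1)).tokens w := by
    intro u
    by_cases hu : u ∈ ((informed x (e i₀)).filter fun u =>
      ∃ j, i₂ ≤ j ∧ j < i₃ ∧ ∃ v, ((e j).phase v).target = some u)
    · obtain ⟨hu0, j, hj2, hj3, v, hv⟩ := Finset.mem_filter.1 hu
      have h5 := E.clock_mono hj2
      have h6 := E.clock_mono hj3.le
      obtain ⟨w, j', h7⟩ := E.exists_informed_step_of_target hH (hclean u hu0) hv
        (by linarith) (l := i₄) (by linarith)
      exact ⟨w, j', fun _ => h7⟩
    · exact ⟨u, 0, fun h => absurd h hu⟩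
  choose w j hwj using key
  refine Finset.card_le_card_of_injOn w (fun u hu => ?_) fun u hu u' hu' huu => ?_
  · obtain ⟨h5, h6, h7, h8, h9⟩ := hwj u hu
    simp only [Finset.coe_sdiff, Set.mem_sdiff, Finset.mem_coe, mem_informed]
    exact ⟨E.tokens_mono h6 h9, fun h => h8 (E.tokens_mono (h01.trans h5) h)⟩
  · obtain ⟨-, -, h7, h8, h9⟩ := hwj u hu
    obtain ⟨-, -, h7', h8', h9'⟩ := hwj u' hu'
    rw [← huu] at h7' h8' h9'
    have hjj : j u = j u' := by
      rcases lt_trichotomy (j u) (j u') with h | h | h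
      · exact absurd (E.tokens_mono h h9) h8'
      · exact h
      · exact absurd (E.tokens_mono h h9') h8
    rw [hjj, h7'] at h7
    exact (Option.some.inj h7).symm

/-- The total rate of the selections of one uninformed process `v` during a period in which it
selects from each process in `N`, a set of clean and untargeted processes. The bound does not depend
on how the scheduler distributes `N` over the selections. -/
theorem le_sum_pullRate_of_process (E : Execution d G H x e m) {α w : ℝ} {i j g : ℕ} {v : V}
    {N : Finset V} (hw0 : 0 ≤ w)
    (hw : ∀ k ∈ Finset.Ico i j, w ≤ spreadWeight α (Fintype.card V) (rank d H x (e k)))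
    (hv : x ∉ (e j).tokens v)
    (hN : ∀ u ∈ N, ∃ k ∈ Finset.Ico i j, m k = .wake v ∧ u ∈ productive H (e k) v)
    (hfresh : ∀ k ∈ Finset.Ico i j, ∀ u ∈ N, Clean d H x (e k) u ∧
      ∀ z, ((e k).phase z).target ≠ some u)
    (hP : ∀ k ∈ Finset.Ico i j, (productive H (e k) v).card ≤ N.card + 2 * g) :
    w * (N.card / (N.card + 2 * g)) ≤
      ∑ k ∈ Finset.Ico i j, if m k = .wake v then pullRate d H x α (e k) (m k) else 0 := by
  -- A selection offers at most `N.card + 2 g` candidates, and each process of `N` is offered once.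
  have hterm : ∀ k ∈ Finset.Ico i j, w * ((if m k = .wake v then
      ((N ∩ productive H (e k) v).card : ℝ) else 0) / (N.card + 2 * g)) ≤
      if m k = .wake v then pullRate d H x α (e k) (m k) else 0 := by
    intro k hk
    split_ifs with hmk
    swap
    · simp
    have hvk : x ∉ (e k).tokens v := fun h => hv (E.tokens_mono (Finset.mem_Ico.1 hk).2.le h)
    rw [hmk, pullRate, if_neg hvk]
    have h1 : (N ∩ productive H (e k) v).card ≤ (freshTargets d H x (e k) v).card := by
      refine Finset.card_le_card fun u hu => ?_
      rw [Finset.mem_inter] at hu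
      exact Finset.mem_filter.2 ⟨hu.2, hfresh k hk u hu.1⟩
    have h1' : ((N ∩ productive H (e k) v).card : ℝ) ≤ (freshTargets d H x (e k) v).card := by
      exact_mod_cast h1
    refine mul_le_mul (hw k hk) ?_ (by positivity) (hw0.trans (hw k hk))
    rcases (productive H (e k) v).eq_empty_or_nonempty with h2 | h2
    · simp [h2]
    · have h3 : (0 : ℝ) < (productive H (e k) v).card := by exact_mod_cast h2.card_pos
      have h4 : ((productive H (e k) v).card : ℝ) ≤ N.card + 2 * g := by exact_mod_cast hP k hk
      exact div_le_div₀ (by positivity) h1' h3 h4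
  refine le_trans ?_ (Finset.sum_le_sum hterm)
  rw [← Finset.mul_sum, ← Finset.sum_div]
  refine mul_le_mul_of_nonneg_left ?_ hw0
  gcongr
  have h1 : N.card ≤ ∑ k ∈ Finset.Ico i j, if m k = .wake v then
      (N ∩ productive H (e k) v).card else 0 := by
    rw [← Finset.sum_filter]
    refine (Finset.card_le_card fun u hu => ?_).trans Finset.card_biUnion_le
    obtain ⟨k, hk, h2, h3⟩ := hN u hu
    exact Finset.mem_biUnion.2 ⟨k, Finset.mem_filter.2 ⟨hk, h2⟩, Finset.mem_inter.2 ⟨hu, h3⟩⟩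
  exact_mod_cast h1

/-- In every period of a certain length, as long as some process is uninformed, the total rate and
the potential of the number of informed processes together grow by a constant: if few processes
become informed, then the selections had a good chance of informing more. -/
theorem exists_progress (E : Execution d G H x e m) (hH : Function.Injective H)
    (hn : 2 ≤ Fintype.card V) (hG : G.Connected) {i₀ : ℕ} (hne : (informed x (e i₀)).Nonempty)
    (huniv : informed x (e i₀) ≠ Finset.univ) :
    ∃ i₄, i₀ ≤ i₄ ∧ (e i₄).clock ≤ (e i₀).clock + (d.old + 48 * d.max) ∧
      1 / 20 ≤ (∑ k ∈ Finset.Ico i₀ i₄, pullRate d H x (vertexExpansion G) (e k) (m k)) +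
        (spreadPotential (vertexExpansion G) (Fintype.card V) (informed x (e i₄)).card -
          spreadPotential (vertexExpansion G) (Fintype.card V) (informed x (e i₀)).card) := by
  have hnontriv : Nontrivial V := Fintype.one_lt_card_iff_nontrivial.1 hn
  have hnbr : ∀ u, ∃ w, G.Adj u w := fun u => by
    obtain ⟨u', hu', w, -, h⟩ := exists_adj_mem_not_mem G hG {u} (by simp) (by
      intro h
      have := congrArg Finset.card h
      rw [Finset.card_singleton, Finset.card_univ] at this
      omega)
    exact ⟨w, Finset.mem_singleton.1 hu' ▸ h⟩
  have hδ := d.max_pos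
  have hold : 0 < d.old := d.update_pos.trans d.update_lt_old
  -- At `i₁` all processes informed at `i₀` are clean; at `i₂` no target is older than that; by `i₃` all
  -- of them have been offered to their uninformed neighbors; by `i₄` the resulting hits have informed.
  obtain ⟨i₁, h01, hc1, hc1'⟩ := E.exists_index_gt hnbr (i := i₀)
    (r := (e i₀).clock + d.old + 13 * d.max) (by linarith)
  obtain ⟨i₂, h12, hc2, hc2'⟩ := E.exists_index_gt hnbr (i := i₁)
    (r := (e i₁).clock + d.max) (by linarith)
  obtain ⟨i₃, h23, hc3, hc3'⟩ := E.exists_index_gt hnbr (i := i₂)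
    (r := (e i₂).clock + 8 * d.max) (by linarith)
  obtain ⟨i₄, h34, hc4, hc4'⟩ := E.exists_index_gt hnbr (i := i₃)
    (r := (e i₃).clock + 2 * d.max) (by linarith)
  refine ⟨i₄, by omega, by linarith, ?_⟩
  set α := vertexExpansion G with hα
  set n := Fintype.card V with hndef
  have hα2 : α ≤ 2 := vertexExpansion_le_two G hn
  have hnα := two_le_card_mul_vertexExpansion G hn hG
  have hn0 : (0 : ℝ) < n := by exact_mod_cast (by omega : 0 < n)
  have hα0 : 0 ≤ α := by
    by_contra hlt
    nlinarith
  set S := informed x (e i₀) with hS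
  set F := informed x (e i₄) \ S with hF
  set T := S.filter fun u => ∃ j, i₂ ≤ j ∧ j < i₃ ∧ ∃ v, ((e j).phase v).target = some u with hT
  set s := S.card with hs
  set g := F.card with hg
  have hS4 : S ⊆ informed x (e i₄) := E.informed_mono (by omega)
  have hSF : S ∪ F = informed x (e i₄) := Finset.union_sdiff_of_subset hS4
  have hcard4 : (informed x (e i₄)).card = s + g := by
    rw [← hSF, Finset.card_union_of_disjoint Finset.disjoint_sdiff]
  have hclean : ∀ u ∈ S, Clean d H x (e i₁) u := fun u hu =>
    E.clean_of_lt hH hnbr (mem_informed.1 hu) (by linarith)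
  have hTg : T.card ≤ g := E.card_targeted_le hH h01 hclean hc2 hc4
  have hsum0 : ∀ A : Finset ℕ, 0 ≤ ∑ k ∈ A, pullRate d H x α (e k) (m k) := fun A =>
    Finset.sum_nonneg fun k _ => pullRate_nonneg _ _
  set κ : ℝ := max 1 (α * min (s : ℝ) (n - s) / 3) with hκ
  have hκ1 : 1 ≤ κ := le_max_left _ _
  have hκ2 : α * min (s : ℝ) (n - s) ≤ 3 * κ := by
    have := le_max_right 1 (α * min (s : ℝ) (n - s) / 3)
    linarith
  have hκs : 1 ≤ √κ := Real.one_le_sqrt.2 hκ1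
  have hκsq : √κ ^ 2 = κ := Real.sq_sqrt (by linarith)
  rw [hcard4]
  -- If many processes become informed, the potential grows; otherwise, the total rate does.
  rcases le_or_gt (√κ / 8) g with hlarge | hsmall
  · have := spreadPotential_gain hα0 hα2 (g := g) hκ1 hκ2 hlarge
    linarith [hsum0 (Finset.Ico i₀ i₄)]
  have hmono := spreadPotential_mono α n (Nat.le_add_right s g)
  suffices h : 1 / 20 ≤ ∑ k ∈ Finset.Ico i₂ i₃, pullRate d H x α (e k) (m k) by
    have h2 : ∑ k ∈ Finset.Ico i₂ i₃, pullRate d H x α (e k) (m k) ≤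
        ∑ k ∈ Finset.Ico i₀ i₄, pullRate d H x α (e k) (m k) :=
      Finset.sum_le_sum_of_subset_of_nonneg
        (Finset.Ico_subset_Ico (by omega) (by omega)) fun k _ _ => pullRate_nonneg _ _
    linarith
  have hcover : ∀ C : Finset V, (∀ u ∈ S, ∀ v ∉ S, G.Adj u v → u ∈ C ∨ v ∈ C) → κ ≤ C.card := by
    intro C hC
    refine max_le ?_ ?_
    · obtain ⟨u, hu, v, hv, huv⟩ := exists_adj_mem_not_mem G hG S hne huniv
      have : C.Nonempty := (hC u hu v hv huv).elim (fun h => ⟨u, h⟩) fun h => ⟨v, h⟩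
      exact_mod_cast this.card_pos
    · have := vertexExpansion_mul_min_le_cover G hn hα0 S C hC
      linarith
  set N : V → Finset V := fun v => (S \ T).filter fun u => G.Adj u v with hN
  have hgraph := cover_le_sum_hit_probability G hTg le_rfl hcover (fun v => (N v).card)
    fun v => rfl
  rw [hSF] at hgraph
  -- The rank is at most twice the number of informed processes, so the weights stay of order `1 / √κ`.
  have hweight : ∀ k ∈ Finset.Ico i₂ i₃, 1 / √(8 * κ) ≤ spreadWeight α n (rank d H x (e k)) := by
    intro k hk
    rw [Finset.mem_Ico] at hk
    refine le_spreadWeight _ _ _ (by linarith) ?_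
    have h1 : rank d H x (e k) ≤ 2 * (informed x (e k)).card := rank_le_two_mul _
    have h2 : (informed x (e k)).card ≤ rank d H x (e k) := card_informed_le_rank _
    have h3 : (informed x (e k)).card ≤ s + g :=
      hcard4 ▸ Finset.card_le_card (E.informed_mono (by omega))
    have h4 : s ≤ (informed x (e k)).card := Finset.card_le_card (E.informed_mono (by omega))
    have h5 : (rank d H x (e k) : ℝ) ≤ 2 * s + 2 * g := by
      exact_mod_cast (by omega : rank d H x (e k) ≤ 2 * s + 2 * g)
    have h6 : (s : ℝ) ≤ rank d H x (e k) := by exact_mod_cast h4.trans h2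
    have h7 : (s : ℝ) ≤ n := by exact_mod_cast Finset.card_le_univ S
    have h8 : min (rank d H x (e k) : ℝ) (n - rank d H x (e k)) ≤
        2 * min (s : ℝ) (n - s) + 2 * g := by
      have hg0 : (0 : ℝ) ≤ g := by positivity
      rcases le_total (s : ℝ) (n - s) with h9 | h9
      · rw [min_eq_left h9]; exact (min_le_left _ _).trans h5
      · rw [min_eq_right h9]; exact (min_le_right _ _).trans (by linarith)
    have h9 := mul_le_mul_of_nonneg_left h8 hα0
    nlinarith
  have hprocess : ∀ v ∈ (informed x (e i₄))ᶜ, 1 / √(8 * κ) * ((N v).card / ((N v).card + 2 * g)) ≤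
      ∑ k ∈ Finset.Ico i₂ i₃, if m k = .wake v then pullRate d H x α (e k) (m k) else 0 := by
    intro v hv
    rw [Finset.mem_compl, mem_informed] at hv
    have hvk : ∀ k ≤ i₄, x ∉ (e k).tokens v := fun k hk h => hv (E.tokens_mono hk h)
    refine E.le_sum_pullRate_of_process (by positivity) hweight (hvk i₃ h34) (fun u hu => ?_)
      (fun k hk u hu => ?_) fun k hk => ?_
    · simp only [hN, Finset.mem_filter, Finset.mem_sdiff] at hu
      obtain ⟨k, h1, h2, h3⟩ := E.exists_wake_of_clean hH hnbr
        (E.clean_mono hH h12 (hclean u hu.1.1)) hu.2 hc3 (hvk i₃ h34)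
      exact ⟨k, Finset.mem_Ico.2 ⟨h1, h2⟩, h3⟩
    · rw [Finset.mem_Ico] at hk
      simp only [hN, Finset.mem_filter, Finset.mem_sdiff] at hu
      refine ⟨E.clean_mono hH (by omega) (hclean u hu.1.1), fun z hz => hu.1.2 ?_⟩
      exact Finset.mem_filter.2 ⟨hu.1.1, k, hk.1, hk.2, z, hz⟩
    · rw [Finset.mem_Ico] at hk
      have hsub : productive H (e k) v ⊆ N v ∪ (T ∪ F) := by
        intro u hu
        have hmem := (E.invariant k).mem_of_mem_productive hu (hvk k (by omega))
        have hu4 : u ∈ S ∪ F := by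
          rw [hSF, mem_informed]; exact E.tokens_mono (by omega) hmem
        simp only [productive, Finset.mem_filter, Finset.mem_univ, true_and] at hu
        obtain ⟨b, hb, -⟩ := hu
        have hadj := ((E.invariant k).nbrs v u b hb).1
        rcases Finset.mem_union.1 hu4 with h | h
        · by_cases huT : u ∈ T
          · simp [huT]
          · refine Finset.mem_union_left _ (Finset.mem_filter.2 ⟨?_, hadj⟩)
            exact Finset.mem_sdiff.2 ⟨h, huT⟩
        · simp [h]
      have h1 := Finset.card_le_card hsub
      have h2 := Finset.card_union_le (N v) (T ∪ F)
      have h3 := Finset.card_union_le T F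
      omega
  have htotal : 1 / √(8 * κ) * ((κ - 2 * g) / (4 * g + 2)) ≤
      ∑ k ∈ Finset.Ico i₂ i₃, pullRate d H x α (e k) (m k) := by
    refine (mul_le_mul_of_nonneg_left hgraph (by positivity)).trans ?_
    rw [Finset.mul_sum]
    refine (Finset.sum_le_sum hprocess).trans ?_
    rw [Finset.sum_comm]
    refine Finset.sum_le_sum fun k _ => ?_
    cases hmk : m k with
    | wake v =>
      have h1 : ∀ v' : V, (Move.wake v : Move V τ) = .wake v' ↔ v = v' := fun v' => by simp
      simp only [h1, Finset.sum_ite_eq]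
      split_ifs
      · exact le_rfl
      · exact pullRate_nonneg _ _
    | _ => simp [pullRate]
  refine le_trans ?_ htotal
  have h8 : √(8 * κ) = √8 * √κ := Real.sqrt_mul (by norm_num) _
  have h9 : √8 ≤ 3 := by rw [Real.sqrt_le_left (by norm_num)]; norm_num
  have h10 : 0 < √8 := by positivity
  have hg0 : (0 : ℝ) ≤ g := by positivity
  have h11 : 3 / 10 * √κ ≤ (κ - 2 * g) / (4 * g + 2) := by
    rw [le_div_iff₀ (by positivity)]
    nlinarith
  rw [h8, one_div_mul_eq_div, le_div_iff₀ (by positivity)]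
  nlinarith

/-- The total rate grows linearly in time until all processes are informed. -/
theorem exists_index_sum_pullRate (E : Execution d G H x e m) (hH : Function.Injective H)
    (hn : 2 ≤ Fintype.card V) (hG : G.Connected) (h0 : (e 0).clock = 0)
    (hne : (informed x (e 0)).Nonempty) {T : ℝ}
    (hT : ∀ i, (e i).clock ≤ T → informed x (e i) ≠ Finset.univ) (w : ℕ)
    (hw : w * (d.old + 48 * d.max) ≤ T) :
    ∃ i, (e i).clock ≤ w * (d.old + 48 * d.max) ∧
      (w : ℝ) / 20 ≤ (∑ k ∈ Finset.range i, pullRate d H x (vertexExpansion G) (e k) (m k)) +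
        spreadPotential (vertexExpansion G) (Fintype.card V) (informed x (e i)).card := by
  have hL : 0 < d.old + 48 * d.max := by
    linarith [d.max_pos, d.update_pos, d.update_lt_old]
  induction w with
  | zero =>
    refine ⟨0, by simp [h0], ?_⟩
    have := spreadPotential_nonneg (vertexExpansion G) (Fintype.card V) (informed x (e 0)).card
    simpa using this
  | succ w ih =>
    push_cast at hw
    obtain ⟨i, hi, hsum⟩ := ih (by linarith)
    obtain ⟨j, hij, hj, hsum'⟩ := E.exists_progress hH hn hG
      (hne.mono (E.informed_mono (Nat.zero_le i))) (hT i (by linarith))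
    refine ⟨j, by push_cast; linarith, ?_⟩
    rw [← Finset.sum_range_add_sum_Ico _ hij]
    push_cast
    linarith

end Execution

section Final

variable [Fintype V] {d : Delays} {G : SimpleGraph V} {H : Finset τ → β} {x : τ}
  {start : V → Finset τ} {σ : Scheduler V τ β}

/-- The history `h'` extends `h` by one step under the scheduler `σ`. -/
def Extends (H : Finset τ → β) (σ : Scheduler V τ β) (h h' : History V τ β) : Prop :=
  ∃ c ∈ (step H h.2 (σ h).1 (σ h).2).support, h' = (h.2 :: h.1, c)

theorem Extends.mem_support {N : ℕ} {h h' : History V τ β} (hh : h ∈ (run H start σ N).support)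
    (hext : Extends H σ h h') : h' ∈ (run H start σ (N + 1)).support := by
  obtain ⟨c, hc, rfl⟩ := hext
  simp only [run, PMF.mem_support_bind_iff, PMF.support_map]
  exact ⟨h, hh, c, hc, rfl⟩

/-- An infinite path that starts in a possible history of length `N` is the tail of an infinite path
from the initial configuration. -/
theorem exists_path_of_tail (N : ℕ) (g : ℕ → History V τ β)
    (h0 : g 0 ∈ (run H start σ N).support) (hg : ∀ k, Extends H σ (g k) (g (k + 1))) :
    ∃ f : ℕ → History V τ β, f 0 = ([], initialConfig H start) ∧
      (∀ k, Extends H σ (f k) (f (k + 1))) ∧ ∀ k, f (N + k) = g k := by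
  induction N generalizing g with
  | zero =>
    rw [run, PMF.mem_support_pure_iff] at h0
    exact ⟨g, h0, hg, fun k => by rw [Nat.zero_add]⟩
  | succ N ih =>
    obtain ⟨h', hh', c, hc, hgc⟩ := mem_support_run_succ h0
    obtain ⟨f, hf0, hf, hfN⟩ := ih (fun k => Nat.casesOn k h' g) hh' fun k => by
      cases k with
      | zero => exact ⟨c, hc, hgc⟩
      | succ k => exact hg k
    exact ⟨f, hf0, hf, fun k => by
      rw [show N + 1 + k = N + (k + 1) by omega]; exact hfN (k + 1)⟩

/-- Every possible finite history is part of an infinite execution. -/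
theorem exists_execution (hs : ∀ u, start u = ∅ ∨ start u = {x}) (α : ℝ)
    (hσ : Admissible d G H start σ) {N : ℕ} {h : History V τ β}
    (hh : h ∈ (run H start σ N).support) :
    ∃ e m, Execution d G H x e m ∧ e 0 = initialConfig H start ∧ e N = h.2 ∧
      (∀ i ≤ N, e i ∈ h.2 :: h.1) ∧
      totalRate d H x α σ h.1 h.2 = ∑ k ∈ Finset.range N, pullRate d H x α (e k) (m k) := by
  have hnext : ∀ h : History V τ β, ∃ h', Extends H σ h h' := fun h => by
    obtain ⟨c, hc⟩ := (step H h.2 (σ h).1 (σ h).2).support_nonempty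
    exact ⟨_, c, hc, rfl⟩
  choose next hnext using hnext
  obtain ⟨f, hf0, hf, hfN⟩ := exists_path_of_tail (start := start) N (fun k => next^[k] h) hh
    fun k => by rw [Function.iterate_succ_apply']; exact hnext _
  have hfN' : f N = h := hfN 0
  have hmem : ∀ k, f k ∈ (run H start σ k).support := by
    intro k
    induction k with
    | zero => rw [hf0, run, PMF.mem_support_pure_iff]
    | succ k ih => exact (hf k).mem_support ih
  have htrans : ∀ k, Transition d G H (f k).2 (σ (f k)).2 (f (k + 1)).2 ∧
      (f (k + 1)).2.clock = (σ (f k)).1 := fun k => by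
    obtain ⟨c, hc, hfk⟩ := hf k
    rw [hfk]
    exact transition_of_mem_support (hσ.enabled k _ (hmem k)) hc
  have hprefix : ∀ n, ∀ i ≤ n, (f i).2 ∈ (f n).2 :: (f n).1 := by
    intro n
    induction n with
    | zero => intro i hi; simp [Nat.le_zero.1 hi]
    | succ n ih =>
      intro i hi
      rcases Nat.of_le_succ hi with hi | rfl
      · obtain ⟨c, -, hfn⟩ := hf n
        rw [hfn]
        exact List.mem_cons_of_mem _ (ih i hi)
      · exact List.mem_cons_self
  have htotal : ∀ n, totalRate d H x α σ (f n).1 (f n).2 =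
      ∑ k ∈ Finset.range n, pullRate d H x α (f k).2 (σ (f k)).2 := by
    intro n
    induction n with
    | zero => rw [hf0]; rfl
    | succ n ih =>
      obtain ⟨c, -, hfn⟩ := hf n
      rw [hfn, Finset.sum_range_succ, ← ih]
      rfl
  refine ⟨fun k => (f k).2, fun k => (σ (f k)).2, ⟨?_, ?_, ?_, ?_⟩, ?_, ?_, ?_, ?_⟩
  · exact fun i => invariant_of_mem_support hs hσ i _ (hmem i)
  · intro i
    rw [(htrans i).2]
    exact hσ.timeOK i _ (hmem i)
  · exact fun i => (htrans i).1
  · intro T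
    obtain ⟨n, hn⟩ := hσ.diverges T
    exact ⟨n, hn _ (hmem n)⟩
  · exact congrArg Prod.snd hf0
  · exact congrArg Prod.snd hfN'
  · rw [← hfN']; exact hprefix N
  · rw [← hfN']; exact htotal N

/-- An execution that has not informed all processes by time `T` has a large total rate. -/
theorem le_totalRate_of_not_spreadBy (hH : Function.Injective H) (hn : 2 ≤ Fintype.card V)
    (hG : G.Connected) (hs : ∀ u, start u = ∅ ∨ start u = {x}) (hs' : ∃ u, start u = {x})
    (hσ : Admissible d G H start σ) {N : ℕ} {h : History V τ β}
    (hh : h ∈ (run H start σ N).support) {T : ℝ} (hT : T < h.2.clock) (hbad : ¬ SpreadBy x T h)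
    (w : ℕ) (hw : w * (d.old + 48 * d.max) ≤ T) :
    (w : ℝ) / 20 - spreadPotential (vertexExpansion G) (Fintype.card V) (Fintype.card V) ≤
      totalRate d H x (vertexExpansion G) σ h.1 h.2 := by
  obtain ⟨e, m, E, h0, hN, hmem, htotal⟩ := exists_execution hs (vertexExpansion G) hσ hh
  have hlt : ∀ i, (e i).clock ≤ T → i < N := fun i hi => by
    by_contra hlt
    have := E.clock_mono (not_lt.1 hlt)
    rw [hN] at this
    linarith
  obtain ⟨u, hu⟩ := hs'
  obtain ⟨i, hi, hsum⟩ := E.exists_index_sum_pullRate hH hn hG (by rw [h0]; rfl)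
    ⟨u, by rw [h0, mem_informed]; simp [initialConfig, hu]⟩ (T := T) (fun i hi huniv =>
      hbad ⟨e i, hmem i (hlt i hi).le, hi, fun u => mem_informed.1 (by rw [huniv]; simp)⟩) w hw
  have hsub : ∑ k ∈ Finset.range i, pullRate d H x (vertexExpansion G) (e k) (m k) ≤
      ∑ k ∈ Finset.range N, pullRate d H x (vertexExpansion G) (e k) (m k) :=
    Finset.sum_le_sum_of_subset_of_nonneg
      (Finset.range_subset_range.2 (hlt i (hi.trans hw)).le) fun k _ _ => pullRate_nonneg _ _
  have hmono := spreadPotential_mono (vertexExpansion G) (Fintype.card V)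
    (Finset.card_le_univ (informed x (e i)))
  rw [htotal]
  linarith

theorem ofReal_one_sub_le_probSpreadBy (hH : Function.Injective H) (hn : 2 ≤ Fintype.card V)
    (hG : G.Connected) (hs : ∀ u, start u = ∅ ∨ start u = {x}) (hs' : ∃ u, start u = {x})
    (hσ : Admissible d G H start σ) {T : ℝ} (w : ℕ) (hw : w * (d.old + 48 * d.max) ≤ T) :
    ENNReal.ofReal (1 - Real.exp
        (3 / 2 * spreadPotential (vertexExpansion G) (Fintype.card V) (Fintype.card V) - w / 40)) ≤
      probSpreadBy H start σ x T := by
  obtain ⟨N, hN⟩ := hσ.diverges T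
  set Ψ := spreadPotential (vertexExpansion G) (Fintype.card V) (Fintype.card V) with hΨ
  have hbad : (run H start σ N).toOuterMeasure {h | SpreadBy x T h}ᶜ ≤
      ENNReal.ofReal (Real.exp (3 / 2 * Ψ - w / 40)) := by
    have h1 := toOuterMeasure_totalRate_le (d := d) (α := vertexExpansion G) hH hs hσ N
      ((w : ℝ) / 20 - Ψ)
    rw [show Ψ - ((w : ℝ) / 20 - Ψ) / 2 = 3 / 2 * Ψ - w / 40 by ring] at h1
    refine le_trans (PMF.toOuterMeasure_mono _ ?_) h1
    rintro h ⟨hbad, hh⟩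
    exact le_totalRate_of_not_spreadBy hH hn hG hs hs' hσ hh (hN h hh) hbad w hw
  refine le_trans ?_ (le_iSup (fun N => (run H start σ N).toOuterMeasure {h | SpreadBy x T h}) N)
  rw [ENNReal.ofReal_sub _ (Real.exp_pos _).le, ENNReal.ofReal_one, tsub_le_iff_right]
  calc (1 : ENNReal) = (run H start σ N).toOuterMeasure
        ({h | SpreadBy x T h} ∪ {h | SpreadBy x T h}ᶜ) := by
        rw [Set.union_compl_self, PMF.toOuterMeasure_apply, Set.indicator_univ, PMF.tsum_coe]
    _ ≤ _ := (MeasureTheory.measure_union_le _ _).trans (by gcongr)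

end Final

end AMTM

end

theorem mainTheorem1 (p K : ℝ) (hp : 0 < p) (hK : 0 < K) :
    ∃ C : ℝ, 0 < C ∧
      ∀ (V : Type*) [Fintype V] (G : SimpleGraph V), 2 ≤ Fintype.card V → G.Connected →
      ∀ (τ β : Type*) (H : Finset τ → β), Function.Injective H →
      ∀ (x : τ) (start : V → Finset τ),
        (∀ u, start u = ∅ ∨ start u = {x}) → (∃ u, start u = {x}) →
      ∀ d : AMTM.Delays, d.old ≤ K * d.max →
      ∀ σ : AMTM.Scheduler V τ β, AMTM.Admissible d G H start σ →
        ENNReal.ofReal (1 - (Fintype.card V : ℝ) ^ (-p)) ≤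
          AMTM.probSpreadBy H start σ x
            (C * (d.max * Real.sqrt (Fintype.card V / vertexExpansion G) *
              Real.log (Fintype.card V * vertexExpansion G) ^ 2)) := by
  refine ⟨4 * (K + 48) * (301 + 120 * p), by positivity, ?_⟩
  intro V _ G hn hG τ β H hH x start hs hs' d hd σ hσ
  set α := vertexExpansion G with hα
  set X := √(Fintype.card V / α) with hX
  have hn2 : (2 : ℝ) ≤ Fintype.card V := by exact_mod_cast hn
  have hnα := two_le_card_mul_vertexExpansion G hn hG
  have hα2 : α ≤ 2 := vertexExpansion_le_two G hn
  have hα0 : 0 < α := by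
    by_contra hle
    nlinarith
  have hδ := d.max_pos
  have hX1 : 1 ≤ X := Real.one_le_sqrt.2 ((one_le_div hα0).2 (by linarith))
  have hlog2 : 1 / 4 ≤ Real.log (Fintype.card V * α) ^ 2 := by
    have h1 := Real.log_le_log (by norm_num) hnα
    have h2 := Real.log_two_gt_d9
    nlinarith
  -- `log n ≤ 2 √n`, and `n = α X² ≤ 2 X²`.
  have hlogn : Real.log (Fintype.card V) ≤ 3 * X := by
    have h1 : Real.log (Fintype.card V) = 2 * Real.log √(Fintype.card V : ℝ) := by
      rw [Real.log_sqrt (by linarith)]; ring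
    have h2 := Real.log_le_sub_one_of_pos (show 0 < √(Fintype.card V : ℝ) by positivity)
    have h3 : √(Fintype.card V : ℝ) ≤ 3 / 2 * X := by
      rw [Real.sqrt_le_left (by positivity), mul_pow, Real.sq_sqrt (by positivity)]
      have h4 : (Fintype.card V : ℝ) / 2 ≤ Fintype.card V / α :=
        div_le_div_of_nonneg_left (by linarith) hα0 hα2
      linarith
    linarith
  have hΨ := spreadPotential_le hα0 hα2 hn
  set L := d.old + 48 * d.max with hL
  have hL0 : 0 < L := by linarith [d.update_pos, d.update_lt_old]
  have hLK : L ≤ (K + 48) * d.max := by linarith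
  set T := 4 * (K + 48) * (301 + 120 * p) *
    (d.max * X * Real.log (Fintype.card V * α) ^ 2) with hT
  have hTL : L * ((301 + 120 * p) * X) ≤ T := by
    calc L * ((301 + 120 * p) * X) ≤ (K + 48) * d.max * ((301 + 120 * p) * X) := by gcongr
      _ = 4 * (K + 48) * (301 + 120 * p) * (d.max * X * (1 / 4)) := by ring
      _ ≤ T := by rw [hT]; gcongr
  have hTL' : (301 + 120 * p) * X ≤ T / L := by
    rw [le_div_iff₀ hL0]; linarith
  refine le_trans ?_ (AMTM.ofReal_one_sub_le_probSpreadBy (d := d) hH hn hG hs hs' hσ ⌊T / L⌋₊ ?_)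
  · apply ENNReal.ofReal_le_ofReal
    rw [Real.rpow_def_of_pos (by linarith)]
    have hfloor := Nat.lt_floor_add_one (T / L)
    have hplog := mul_le_mul_of_nonneg_left hlogn hp.le
    have : 3 / 2 * spreadPotential α (Fintype.card V) (Fintype.card V) -
        (⌊T / L⌋₊ : ℝ) / 40 ≤ Real.log (Fintype.card V) * -p := by nlinarith
    have := Real.exp_le_exp.2 this
    linarith
  · rw [← le_div_iff₀ hL0]
    exact Nat.floor_le ((by positivity : (0 : ℝ) ≤ (301 + 120 * p) * X).trans hTL')
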